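/- Let $W=\mathbb Z^4$ and $V=W\oplus W^*$ with basis $e_1,\dots,e_4$ of $W$ and dual basis $e_5,\dots,e_8$ of $W^*$, and with the form $(x,y)_V=\sum_{i=1}^4 (x_iy_{i+4}+x_{i+4}y_i)$. Let $S^+=\mathbb Z^8$ with coordinates $z_1,\dots,z_8$ and the form given by the same formula, embedded in $\bigwedge^{\rm even}W$ by $$z\mapsto z_1+z_2e_1e_2+z_3e_1e_3+z_4e_1e_4+z_5e_1e_2e_3e_4-z_6e_3e_4+z_7e_2e_4-z_8e_2e_3 .$$ For a field $F$ of characteristic $0$, $(w,w^*)\in V_F$ acts on $\bigwedge W_F$ by $\eta\mapsto w\wedge\eta+D_{w^*}\eta$, where $D_{w^*}$ is contraction with $w^*$. For a non-zero isotropic $\ell\in S^+_F$ let $Z_\ell\subset V_F$ be the subspace of vectors annihilating $\ell$; it is the maximal isotropic subspace that corresponds to $[\ell]$ under the spinor map. Let $h,s\in S^+$ be perpendicular and such that $\langle h,s\rangle$ is a positive definite sublattice of rank two, let $d=(h,h)(s,s)$ and $K=\mathbb Q(\sqrt{-d})$. Let $\kappa\in\langle h,s\rangle_K$ be a non-zero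 isotropic vector (it is determined up to a scalar and up to conjugation). Let $$\Omega_{\{h,s\}^\perp}=\{[\ell]\in\mathbb P S^+_{\mathbb C}:\ (\ell,\ell)=0,\ (\ell,\bar\ell)>0,\ (\ell,h)=(\ell,s)=0\}.$$ For $\ell\in\Omega_{\{h,s\}^\perp}$ let $\mathcal T_\ell$ be the complex torus with $H^1(\mathcal T_\ell,\mathbb Z)=V$ and $H^{1,0}(\mathcal T_\ell)=Z_\ell$. Then there is a unique action of $K$ on $V_{\mathbb Q}$ such that $x\cdot(v_1+\overline{v_1})=xv_1+\overline{xv_1}$ for all $x\in K$ and all $v_1\in Z_\kappa\subset V_K$. Let $\omega_E\in H^2(\mathcal T_\ell,\mathbb Q)=\bigwedge^2V_{\mathbb Q}$ be the class that corresponds to the form $E(v,w)=(\sqrt{-d}\cdot v,w)_V$ on $V_{\mathbb Q}$ when $V_{\mathbb Q}$ is identified with $H_1(\mathcal T_\ell,\mathbb Q)=\operatorname{Hom}(V,\mathbb Q)$ by $(\cdot,\cdot)_V$. For one of the two signs, $\omega_K=\pm\omega_E$ is such that $(\mathcal T_\ell,K,\omega_K)$ is a polarized abelian fourfold of Weil type;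 that is, $\mathcal T_\ell$ is a complex torus with $K\subset\operatorname{End}(\mathcal T_\ell)_{\mathbb Q}$ (the action on $H^1$ being the one above), each $x\in K\setminus\mathbb Q$ acts on $H^{1,0}(\mathcal T_\ell)$ with eigenvalues $x,\bar x$ of the same multiplicity, $\omega_K\in H^2(\mathcal T_\ell,\mathbb Z)$ is a polarization, and $x^*\omega_K=x\bar x\,\omega_K$ for all $x\in K$. Its discriminant is trivial: for the Hermitian form $$H(x,y)=\omega_K(x,(\sqrt{-d})_*y)+\sqrt{-d}\,\omega_K(x,y)$$ on the $K$-vector space $H_1(\mathcal T_\ell,\mathbb Q)$ and any $K$-basis $b_1,\dots,b_4$ of it, $\det(H(b_i,b_j))_{i,j}$ is the norm $x\bar x$ of some $x\in K^\times$. The same holds for the Hermitian form defined by $c\,\omega_E$, for any $c\in\mathbb Q^\times$. -/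

import Mathlib

namespace SpinorTori

noncomputable section

/-- The index set of the eight coordinates: `inl i` stands for `e_{i+1}`, `inr i` for `e_{i+5}`
(`i = 0, 1, 2, 3`). -/
abbrev Idx : Type := Fin 4 ⊕ Fin 4

/-- `V_R = W_R ⊕ W_R^*` with `W = ℤ⁴`, in the basis `e₁, …, e₄` of `W` and its dual basis
`e₅, …, e₈` of `W^*`.  The lattice `V` is `V ℤ`. -/
abbrev V (R : Type*) : Type _ := Idx → R

/-- `S⁺_R`, the even half-spin module, in the coordinates `z₁, …, z₈`: the coordinate `z_{i+1}` is
at `inl i` and `z_{i+5}` is at `inr i`.  The lattice `S⁺` is `SPlus ℤ`. -/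
abbrev SPlus (R : Type*) : Type _ := Idx → R

/-- The hyperbolic form `U^{⊕4}`, both on `V_R` and on `S⁺_R`:
`(x, y) = ∑ᵢ xᵢ yᵢ₊₄ + xᵢ₊₄ yᵢ`. -/
def form {R : Type*} [CommRing R] (x y : Idx → R) : R :=
  ∑ i : Fin 4, (x (Sum.inl i) * y (Sum.inr i) + x (Sum.inr i) * y (Sum.inl i))

/-- The image in `S⁺_R` of an element of the lattice `S⁺`. -/
def ofLattice (R : Type*) [CommRing R] (v : SPlus ℤ) : SPlus R := fun i => (v i : R)

/-! ### Spinors -/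

/-- The basis vector `e_{i+1}` of `W_R`, in the exterior algebra of `W_R`. -/
def e (R : Type*) [CommRing R] (i : Fin 4) : ExteriorAlgebra R (Fin 4 → R) :=
  ExteriorAlgebra.ι R (Pi.single i 1)

/-- The element of `⋀^{even} W_R` with coordinates `z₁, …, z₈`; the basis is
`1, e₁e₂, e₁e₃, e₁e₄, e₁e₂e₃e₄, -e₃e₄, e₂e₄, -e₂e₃`, for which the spinor map sends the isotropic
space spanned by the columns of `(B, I)`, `B = (b_{ij})` alternating, to
`(1 : b₁₂ : b₁₃ : b₁₄ : b₁₂b₃₄ - b₁₃b₂₄ + b₁₄b₂₃ : -b₃₄ : b₂₄ : -b₂₃)`. -/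
def toExterior {R : Type*} [CommRing R] (z : SPlus R) : ExteriorAlgebra R (Fin 4 → R) :=
  z (Sum.inl 0) • 1
    + z (Sum.inl 1) • (e R 0 * e R 1)
    + z (Sum.inl 2) • (e R 0 * e R 2)
    + z (Sum.inl 3) • (e R 0 * e R 3)
    + z (Sum.inr 0) • (e R 0 * e R 1 * e R 2 * e R 3)
    - z (Sum.inr 1) • (e R 2 * e R 3)
    + z (Sum.inr 2) • (e R 1 * e R 3)
    - z (Sum.inr 3) • (e R 1 * e R 2)

/-- Clifford multiplication of `v = (w, w^*) ∈ V_R = W_R ⊕ W_R^*` on `⋀ W_R`: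
`η ↦ w ∧ η + D_{w^*} η`, where `D_{w^*}` is contraction with `w^*`. -/
def clifford {R : Type*} [CommRing R] (v : V R) (η : ExteriorAlgebra R (Fin 4 → R)) :
    ExteriorAlgebra R (Fin 4 → R) :=
  ExteriorAlgebra.ι R (fun i => v (Sum.inl i)) * η
    + CliffordAlgebra.contractLeft (Q := (0 : QuadraticForm R (Fin 4 → R)))
        (∑ i : Fin 4, v (Sum.inr i) • LinearMap.proj (R := R) (φ := fun _ : Fin 4 => R) i) η

/-- `Z_ℓ ⊆ V_R`, the space of vectors that annihilate the spinor `ℓ ∈ S⁺_R`.  Over a field, if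
`ℓ ≠ 0` and `(ℓ, ℓ) = 0`, this is the maximal isotropic subspace whose image under the spinor map
is the point `[ℓ]` of the spinor quadric. -/
def Z {R : Type*} [CommRing R] (l : SPlus R) : Submodule R (V R) where
  carrier := {v | clifford v (toExterior l) = 0}
  zero_mem' := by
    have h : (fun i : Fin 4 => (0 : V R) (Sum.inl i)) = 0 := rfl
    change clifford 0 (toExterior l) = 0
    rw [clifford, h]
    simp
  add_mem' := by
    intro v w hv hw
    have h : (fun i : Fin 4 => (v + w) (Sum.inl i))
        = (fun i => v (Sum.inl i)) + fun i => w (Sum.inl i) := rfl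
    simp only [Set.mem_ofPred_eq, clifford] at hv hw ⊢
    rw [h, map_add, add_mul]
    simp only [Pi.add_apply, add_smul, Finset.sum_add_distrib, map_add, LinearMap.add_apply]
    rw [add_add_add_comm, hv, hw, add_zero]
  smul_mem' := by
    intro c v hv
    have h : (fun i : Fin 4 => (c • v) (Sum.inl i)) = c • fun i => v (Sum.inl i) := rfl
    simp only [Set.mem_ofPred_eq, clifford] at hv ⊢
    rw [h, map_smul, smul_mul_assoc]
    simp only [Pi.smul_apply, smul_assoc, ← Finset.smul_sum, map_smul, LinearMap.smul_apply]
    rw [← smul_add, hv, smul_zero]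

/-- The cone over `Ω_{{h,s}^⊥}`: the vectors `ℓ ∈ S⁺_ℂ` with `(ℓ, ℓ) = 0`, `(ℓ, ℓ̄) > 0` (this
number is always real) and `(ℓ, h) = (ℓ, s) = 0`. -/
def periodDomain (h s : SPlus ℤ) : Set (SPlus ℂ) :=
  {l | form l l = 0 ∧ 0 < (form l (star l)).re ∧
    form l (ofLattice ℂ h) = 0 ∧ form l (ofLattice ℂ s) = 0}

/-! ### The imaginary quadratic field -/

/-- `K = ℚ(√-d)`; the element `a + b √-d` is `⟨a, b⟩`, `star` is the conjugation and
`QuadraticAlgebra.norm` is the norm `x ↦ x x̄`.  (It is only used for `d > 0`.) -/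
abbrev K (d : ℚ) : Type := QuadraticAlgebra ℚ (-d) 0

/-- The element `√-d` of `K`. -/
def sqrtNeg (d : ℚ) : K d := ⟨0, 1⟩

/-- The complex embedding `a + b √-d ↦ a + b √d i` of `K`. -/
def embed (d : ℚ) (x : K d) : ℂ := (x.re : ℂ) + (x.im : ℂ) * ((Real.sqrt (d : ℝ) : ℂ) * Complex.I)

/-! ### Polarized abelian varieties of Weil type

A complex torus `A` with `H¹(A, ℤ) = ℤ^ι` is given by its weight one Hodge structure, that is by
`H = H^{1,0}(A) ⊆ ℂ^ι = H¹(A, ℂ)`.  The spaces `H_1(A, F) = Hom(H¹(A, ℤ), F)` are identified with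
`ι → F` by the dual basis, the pairing with `H¹` being the dot product.  An element of `End(A)_ℚ`
is given by the matrix `x^*` of its action on `H¹(A, ℚ)`; it acts on `H_1(A, ℚ)` by the
transpose.  A class `ω ∈ H²(A, ℚ) = ⋀² H¹(A, ℚ)` is given by the matrix of the alternating form
that it defines on `H_1(A, ℚ)`. -/

/-- The complex conjugate of a subspace of `ℂ^ι`. -/
def conjSubspace {ι : Type*} (H : Submodule ℂ (ι → ℂ)) : Submodule ℂ (ι → ℂ) where
  carrier := {v | star v ∈ H}
  zero_mem' := by simp
  add_mem' := by
    intro v w hv hw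
    simpa using H.add_mem hv hw
  smul_mem' := by
    intro c v hv
    simpa using H.smul_mem (star c) hv

section Weil

variable {ι : Type*} [Fintype ι] [DecidableEq ι]

/-- The subspace of `H_1(A, ℂ)` of the functionals that vanish on `H ⊆ H¹(A, ℂ)`. -/
def annihilator (H : Submodule ℂ (ι → ℂ)) : Set (ι → ℂ) := {φ | ∀ v ∈ H, φ ⬝ᵥ v = 0}

/-- The matrix of an endomorphism of `H¹(A, ℚ)`, or of a rational 2-form, over `ℂ`. -/
def complexify (M : Matrix ι ι ℚ) : Matrix ι ι ℂ := M.map (algebraMap ℚ ℂ)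

/-- The `μ`-eigenspace in `H^{1,0}(A)` of an endomorphism of `H¹(A, ℚ)`. -/
def eigenIn (H : Submodule ℂ (ι → ℂ)) (M : Matrix ι ι ℚ) (μ : ℂ) : Submodule ℂ (ι → ℂ) :=
  H ⊓ Module.End.eigenspace (Matrix.toLin' (complexify M)) μ

/-- `ω` is a polarization of the torus with `H^{1,0} = H`: an integral class of type `(1,1)`,
positive on the holomorphic tangent space, which is the annihilator of `H^{0,1}` in `H_1(A, ℂ)`
(so that `-i ω(φ, φ̄) = 2 ω(u, Ju)` is positive for `φ = u - i J u`). -/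
structure IsPolarization (H : Submodule ℂ (ι → ℂ)) (ω : Matrix ι ι ℚ) : Prop where
  alternating : ω.transpose = -ω
  integral : ∃ N : Matrix ι ι ℤ, ω = N.map (Int.cast : ℤ → ℚ)
  type_one_one : ∀ φ ∈ annihilator H, ∀ ψ ∈ annihilator H, φ ⬝ᵥ (complexify ω).mulVec ψ = 0
  positive : ∀ φ ∈ annihilator (conjSubspace H), φ ≠ 0 →
    0 < (-Complex.I * (φ ⬝ᵥ (complexify ω).mulVec (star φ))).re

/-- `(A, K, ω)` is a polarized abelian variety of Weil type with field `K = ℚ(√-d)`; here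
`ρ x = x^*` on `H¹(A, ℚ)`. -/
structure IsPolarizedWeilType (d : ℚ) (H : Submodule ℂ (ι → ℂ)) (ρ : K d →ₐ[ℚ] Matrix ι ι ℚ)
    (ω : Matrix ι ι ℚ) : Prop where
  torus : IsCompl H (conjSubspace H)
  endomorphism : ∀ x : K d, ∀ v ∈ H, (complexify (ρ x)).mulVec v ∈ H
  polarization : IsPolarization H ω
  /-- `x ∉ ℚ` acts on `H^{1,0}` with eigenvalues `x` and `x̄`, of the same multiplicity. -/
  eigenvalues : ∀ x : K d, x.im ≠ 0 →
    eigenIn H (ρ x) (embed d x) ⊔ eigenIn H (ρ x) (embed d (star x)) = H ∧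
    Module.finrank ℂ (eigenIn H (ρ x) (embed d x))
      = Module.finrank ℂ (eigenIn H (ρ x) (embed d (star x)))
  /-- `x^* ω = Nm(x) ω`. -/
  norm : ∀ x : K d, ρ x * ω * (ρ x).transpose = QuadraticAlgebra.norm x • ω

/-- `b` is a basis of `H_1(A, ℚ)` as a vector space over `K`, which acts by `x_* = (x^*)ᵀ`. -/
def IsKBasis {d : ℚ} (ρ : K d →ₐ[ℚ] Matrix ι ι ℚ) {n : ℕ} (b : Fin n → ι → ℚ) : Prop :=
  Function.Bijective fun c : Fin n → K d => ∑ i, (ρ (c i)).transpose.mulVec (b i)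

/-- The Hermitian form `H(x, y) = ω(x, (√-d)_* y) + √-d ω(x, y)` on `H_1(A, ℚ)`. -/
def hermitian {d : ℚ} (ρ : K d →ₐ[ℚ] Matrix ι ι ℚ) (ω : Matrix ι ι ℚ) (x y : ι → ℚ) : K d :=
  algebraMap ℚ (K d) (x ⬝ᵥ ω.mulVec ((ρ (sqrtNeg d)).transpose.mulVec y))
    + sqrtNeg d * algebraMap ℚ (K d) (x ⬝ᵥ ω.mulVec y)

/-- The discriminant of `(A, K, ω)` is trivial: `H_1(A, ℚ)` has a `K`-basis, and for every
`K`-basis the determinant of the matrix of the Hermitian form is the norm of a non-zero element of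
`K`, i.e. its class in `ℚ^×/Nm(K^×)` is trivial. -/
def HasTrivialDiscriminant {d : ℚ} (ρ : K d →ₐ[ℚ] Matrix ι ι ℚ) (ω : Matrix ι ι ℚ) : Prop :=
  (∃ (n : ℕ) (b : Fin n → ι → ℚ), IsKBasis ρ b) ∧
  ∀ (n : ℕ) (b : Fin n → ι → ℚ), IsKBasis ρ b →
    ∃ x : K d, x ≠ 0 ∧
      (Matrix.of fun i j => hermitian ρ ω (b i) (b j)).det
        = algebraMap ℚ (K d) (QuadraticAlgebra.norm x)

end Weil

/-! ### The action of `K` on `V_ℚ` and the class `ω_K` -/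

/-- `ρ` is the action of `K` on `V_ℚ` defined by the isotropic line spanned by `κ ∈ S⁺_K`: if
`v = v₁ + v̄₁` with `v₁ ∈ Z_κ ⊆ V_K`, then `x · v = x v₁ + conj(x v₁)`. -/
def IsActionOf {d : ℚ} (κ : SPlus (K d)) (ρ : K d →ₐ[ℚ] Matrix Idx Idx ℚ) : Prop :=
  ∀ (x : K d) (v : V ℚ), ∀ v₁ ∈ Z κ,
    (fun i => algebraMap ℚ (K d) (v i)) = v₁ + star v₁ →
    (fun i => algebraMap ℚ (K d) ((ρ x).mulVec v i)) = x • v₁ + star (x • v₁)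

/-- The form `E(v, w) = (√-d · v, w)_V` on `V_ℚ`. -/
def formE {d : ℚ} (ρ : K d →ₐ[ℚ] Matrix Idx Idx ℚ) (v w : V ℚ) : ℚ :=
  form ((ρ (sqrtNeg d)).mulVec v) w

/-- The class in `⋀² V_ℚ` defined by `E`, as a form on `Hom(V, ℚ)`, which is identified with `V_ℚ`
by means of `(·,·)_V`: the coordinate functional `v ↦ v i` corresponds to the basis vector with
index `i.swap`. -/
def omegaK {d : ℚ} (ρ : K d →ₐ[ℚ] Matrix Idx Idx ℚ) : Matrix Idx Idx ℚ :=
  Matrix.of fun i j => formE ρ (Pi.single i.swap 1) (Pi.single j.swap 1)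

end

end SpinorTori

open SpinorTori

/-! Everything rests on Clifford multiplication read as a bilinear pairing of `V` with the even
spinors. For a spinor `z`, `cliff z` is the operator `v ↦ v · z` into the odd spinors and `cliffAdj
z` is its adjoint. The Clifford relation `cliffAdj z * cliff w + cliffAdj w * cliff z = form z w •
1` and its mirror image make orthogonal spinors anticommute, and `Z z` is the kernel of `cliff z`.

Action. For orthogonal `h`, `s` the operator `turn h s = 2 • (cliffAdj h * cliff s)` is skew, has
square `-(h,h)(s,s)`, and preserves `Z l` whenever `l` is orthogonal to both. Multiplying the
equation of `Z κ` by `cliffAdj h` turns it into an eigenvalue equation for `turn h s`, so `√-d` must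
act as `± turn h s` (`exists_sign_mem_Z_iff`, `isActionOf_iff`).

Polarization. The type is (1,1) because `Z l` is isotropic and stable. For positivity let `C` be the
product `cliffProd` of the Clifford operators of `h`, `s`, `Re l`, `Im l`, which span a positive
definite 4-space. On `Z l` the last two factors act by an imaginary scalar, so there `C` is
proportional to `turn h s`, and positivity up to sign becomes definiteness of the real form `(v, C
v)`. This form cannot vanish on an anisotropic `v`: otherwise signature (4,4) would contain a
definite 5-space (`form_cliffProd_ne_zero`). Since `C` is self-adjoint with positive scalar square
and anticommutes with an anti-similitude, its two eigenspaces are definite of opposite signs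
(`definite_of_anticommute`).

Weil type. A real spinor `t` orthogonal to those four gives an operator `turn h t` that preserves `Z
l` and anticommutes with `turn h s`, so it exchanges the two eigenspaces.

Discriminant. There is a rational isotropic spinor `z` orthogonal to `h` and `s`. Its `Z z` is
rational, stable under `K` and isotropic of dimension at least four over `ℚ`, so the Hermitian form
of rank four contains an isotropic `K`-plane. Its determinant is then a norm, whatever the scaling
of the form. -/

namespace SpinorTori

open Matrix

/-! ### Clifford multiplication as matrices -/

section CliffordMatrix

variable {R : Type*} [CommRing R]

/-- The Gram matrix of `form`. -/
def swapMatrix (R : Type*) [CommRing R] : Matrix Idx Idx R := Matrix.fromBlocks 0 1 1 0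

/-- A skew matrix with first row `-(a₁, a₂, a₃)` and a cross product block built from `b`. -/
def skew (a b : Fin 4 → R) : Matrix (Fin 4) (Fin 4) R :=
  !![0, -a 1, -a 2, -a 3; a 1, 0, b 3, -b 2; a 2, -b 3, 0, b 1; a 3, b 2, -b 1, 0]

/-- The matrix of `v ↦ v · z` from `V` to the odd half-spin module with the basis
`e₁, e₂, e₃, e₄, e₂e₃e₄, -e₁e₃e₄, e₁e₂e₄, -e₁e₂e₃`. -/
def cliff (z : SPlus R) : Matrix Idx Idx R :=
  Matrix.fromBlocks (z (Sum.inl 0) • 1) (skew (z ∘ Sum.inl) (z ∘ Sum.inr))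
    (skew (z ∘ Sum.inr) (z ∘ Sum.inl)) (z (Sum.inr 0) • 1)

/-- The adjoint of `cliff z` with respect to `form`. -/
def cliffAdj (z : SPlus R) : Matrix Idx Idx R :=
  Matrix.fromBlocks (z (Sum.inr 0) • 1) (-skew (z ∘ Sum.inl) (z ∘ Sum.inr))
    (-skew (z ∘ Sum.inr) (z ∘ Sum.inl)) (z (Sum.inl 0) • 1)

theorem skew_transpose (a b : Fin 4 → R) : (skew a b)ᵀ = -skew a b := by
  ext i j
  fin_cases i <;> fin_cases j <;> simp [skew]

/-- This polarizes the Pfaffian identity `A * A' = Pf A • 1` for an alternating 4 × 4 matrix `A =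
skew a b` and its dual `A' = skew b a`. It is the only nontrivial computation behind the Clifford
relations. -/
theorem skew_mul_skew (a b c d : Fin 4 → R) :
    skew a b * skew c d + skew d c * skew b a
      = -(∑ i : Fin 3, (a i.succ * c i.succ + b i.succ * d i.succ)) • 1 := by
  ext i j
  fin_cases i <;> fin_cases j <;>
    simp [skew, Fin.sum_univ_succ] <;> ring

theorem skew_add (a b c d : Fin 4 → R) : skew (a + c) (b + d) = skew a b + skew c d := by
  ext i j
  fin_cases i <;> fin_cases j <;> simp [skew] <;> ring

theorem skew_smul (t : R) (a b : Fin 4 → R) : skew (t • a) (t • b) = t • skew a b := by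
  ext i j
  fin_cases i <;> fin_cases j <;> simp [skew]

theorem skew_map {S : Type*} [CommRing S] (f : R →+* S) (a b : Fin 4 → R) :
    (skew a b).map f = skew (f ∘ a) (f ∘ b) := by
  ext i j
  fin_cases i <;> fin_cases j <;> simp [skew]

theorem swapMatrix_mul_self : swapMatrix R * swapMatrix R = 1 := by
  simp [swapMatrix, Matrix.fromBlocks_multiply]

theorem swapMatrix_transpose : (swapMatrix R)ᵀ = swapMatrix R := by
  simp [swapMatrix, Matrix.fromBlocks_transpose]

theorem swapMatrix_map {S : Type*} [CommRing S] (f : R →+* S) :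
    (swapMatrix R).map f = swapMatrix S := by
  simp [swapMatrix, Matrix.fromBlocks_map]

theorem form_eq_dotProduct (x y : Idx → R) : form x y = x ⬝ᵥ swapMatrix R *ᵥ y := by
  simp [form, swapMatrix, dotProduct, Matrix.fromBlocks_mulVec, Finset.sum_add_distrib]

theorem cliffAdj_eq (z : SPlus R) :
    cliffAdj z = swapMatrix R * (cliff z)ᵀ * swapMatrix R := by
  simp [swapMatrix, cliff, cliffAdj, Matrix.fromBlocks_transpose, Matrix.fromBlocks_multiply,
    skew_transpose]

theorem form_comm (x y : Idx → R) : form x y = form y x := by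
  simp only [form, mul_comm, add_comm]

theorem form_add_right (x y z : Idx → R) : form x (y + z) = form x y + form x z := by
  simp only [form_eq_dotProduct, Matrix.mulVec_add, dotProduct_add]

theorem form_add_left (x y z : Idx → R) : form (x + y) z = form x z + form y z := by
  simp only [form_eq_dotProduct, add_dotProduct]

theorem form_smul_right (c : R) (x y : Idx → R) : form x (c • y) = c * form x y := by
  simp only [form_eq_dotProduct, Matrix.mulVec_smul, dotProduct_smul, smul_eq_mul]

theorem form_smul_left (c : R) (x y : Idx → R) : form (c • x) y = c * form x y := by
  simp only [form_eq_dotProduct, smul_dotProduct, smul_eq_mul]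

theorem form_map {S : Type*} [CommRing S] (f : R →+* S) (x y : Idx → R) :
    form (f ∘ x) (f ∘ y) = f (form x y) := by
  simp [form]

theorem form_cliff (z : SPlus R) (v w : Idx → R) :
    form (cliff z *ᵥ v) w = form v (cliffAdj z *ᵥ w) := by
  rw [form_eq_dotProduct, form_eq_dotProduct, Matrix.mulVec_mulVec, cliffAdj_eq,
    ← Matrix.mul_assoc, ← Matrix.mul_assoc, swapMatrix_mul_self, Matrix.one_mul,
    ← Matrix.mulVec_mulVec, Matrix.dotProduct_transpose_mulVec,
    dotProduct_comm (_ *ᵥ v), ← Matrix.dotProduct_transpose_mulVec]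

theorem form_cliffAdj (z : SPlus R) (v w : Idx → R) :
    form (cliffAdj z *ᵥ v) w = form v (cliff z *ᵥ w) := by
  rw [form_comm, ← form_cliff, form_comm]

theorem eq_zero_of_form_eq_zero {x : Idx → R} (hx : ∀ y, form x y = 0) : x = 0 := by
  funext i
  have := hx (Pi.single i.swap 1)
  rcases i with i | i <;> simpa [form, Pi.single_apply, Finset.sum_add_distrib] using this

theorem form_eq (z w : SPlus R) : form z w
    = z (Sum.inl 0) * w (Sum.inr 0) + z (Sum.inr 0) * w (Sum.inl 0)
      + ∑ i : Fin 3, (z (Sum.inl i.succ) * w (Sum.inr i.succ)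
        + z (Sum.inr i.succ) * w (Sum.inl i.succ)) := by
  rw [form, Fin.sum_univ_succ]

/-- The diagonal blocks are the polarized Pfaffian identity plus the products of the two remaining
coordinates; the off-diagonal blocks cancel. -/
theorem cliffAdj_mul_cliff (z w : SPlus R) :
    cliffAdj z * cliff w + cliffAdj w * cliff z = form z w • 1 := by
  have h1 := skew_mul_skew (z ∘ Sum.inl) (z ∘ Sum.inr) (w ∘ Sum.inr) (w ∘ Sum.inl)
  have h2 := skew_mul_skew (z ∘ Sum.inr) (z ∘ Sum.inl) (w ∘ Sum.inl) (w ∘ Sum.inr)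
  simp only [cliff, cliffAdj, Matrix.fromBlocks_multiply, Matrix.fromBlocks_add,
    ← Matrix.fromBlocks_one, Matrix.fromBlocks_smul, form_eq, smul_zero]
  congr 1
  · rw [Matrix.neg_mul, Matrix.neg_mul, add_add_add_comm, ← neg_add, h1]
    simp only [Matrix.smul_mul, Matrix.mul_smul, Matrix.one_mul, Function.comp]
    module
  · simp only [Matrix.smul_mul, Matrix.mul_smul, Matrix.one_mul, Matrix.mul_one]
    module
  · simp only [Matrix.smul_mul, Matrix.mul_smul, Matrix.one_mul, Matrix.mul_one]
    module
  · rw [Matrix.neg_mul, Matrix.neg_mul, add_add_add_comm, ← neg_add, h2]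
    simp only [Matrix.smul_mul, Matrix.mul_smul, Matrix.one_mul, Function.comp,
      Finset.sum_add_distrib]
    module

theorem cliff_mul_cliffAdj (z w : SPlus R) :
    cliff z * cliffAdj w + cliff w * cliffAdj z = form z w • 1 := by
  have h1 := skew_mul_skew (z ∘ Sum.inl) (z ∘ Sum.inr) (w ∘ Sum.inr) (w ∘ Sum.inl)
  have h2 := skew_mul_skew (z ∘ Sum.inr) (z ∘ Sum.inl) (w ∘ Sum.inl) (w ∘ Sum.inr)
  simp only [cliff, cliffAdj, Matrix.fromBlocks_multiply, Matrix.fromBlocks_add,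
    ← Matrix.fromBlocks_one, Matrix.fromBlocks_smul, form_eq, smul_zero]
  congr 1
  · rw [Matrix.mul_neg, Matrix.mul_neg, add_add_add_comm, ← neg_add, h1]
    simp only [Matrix.smul_mul, Matrix.mul_smul, Matrix.one_mul, Function.comp]
    module
  · simp only [Matrix.smul_mul, Matrix.mul_smul, Matrix.one_mul, Matrix.mul_one]
    module
  · simp only [Matrix.smul_mul, Matrix.mul_smul, Matrix.one_mul, Matrix.mul_one]
    module
  · rw [Matrix.mul_neg, Matrix.mul_neg, add_add_add_comm, ← neg_add, h2]
    simp only [Matrix.smul_mul, Matrix.mul_smul, Matrix.one_mul, Function.comp,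
      Finset.sum_add_distrib]
    module

theorem cliff_add (z w : SPlus R) : cliff (z + w) = cliff z + cliff w := by
  simp only [cliff, Matrix.fromBlocks_add, Pi.add_apply, add_smul, ← skew_add]
  rfl

theorem cliff_smul (t : R) (z : SPlus R) : cliff (t • z) = t • cliff z := by
  simp only [cliff, Matrix.fromBlocks_smul, Pi.smul_apply, smul_assoc, ← skew_smul]
  rfl

theorem cliff_map {S : Type*} [CommRing S] (f : R →+* S) (z : SPlus R) :
    (cliff z).map f = cliff (f ∘ z) := by
  simp only [cliff, Matrix.fromBlocks_map, skew_map]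
  congr 1 <;> ext i j <;> by_cases hij : i = j <;> simp [hij]

theorem cliffAdj_map {S : Type*} [CommRing S] (f : R →+* S) (z : SPlus R) :
    (cliffAdj z).map f = cliffAdj (f ∘ z) := by
  rw [cliffAdj_eq, cliffAdj_eq, Matrix.map_mul, Matrix.map_mul, swapMatrix_map,
    Matrix.transpose_map, cliff_map]

end CliffordMatrix

/-! ### Comparison with the exterior algebra -/

section Spinor

variable {R : Type*} [CommRing R]

theorem ι_eq_sum_e (w : Fin 4 → R) : ExteriorAlgebra.ι R w = ∑ i, w i • e R i := by
  conv_lhs => rw [pi_eq_sum_univ' w]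
  simp [e]

/-- Contraction with the functional with coordinates `a`. -/
def contract (a : Fin 4 → R) :
    ExteriorAlgebra R (Fin 4 → R) →ₗ[R] ExteriorAlgebra R (Fin 4 → R) :=
  CliffordAlgebra.contractLeft (Q := (0 : QuadraticForm R (Fin 4 → R)))
    (∑ i : Fin 4, a i • LinearMap.proj (R := R) (φ := fun _ : Fin 4 => R) i)

theorem contract_e_mul (a : Fin 4 → R) (i : Fin 4) (x : ExteriorAlgebra R (Fin 4 → R)) :
    contract a (e R i * x) = a i • x - e R i * contract a x := by
  have := CliffordAlgebra.contractLeft_ι_mul (Q := (0 : QuadraticForm R (Fin 4 → R)))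
    (d := ∑ i : Fin 4, a i • LinearMap.proj (R := R) (φ := fun _ : Fin 4 => R) i)
    (Pi.single i 1) x
  rw [contract, e, ExteriorAlgebra.ι]
  refine this.trans ?_
  simp [Pi.single_apply]

theorem contract_one (a : Fin 4 → R) : contract a 1 = 0 :=
  CliffordAlgebra.contractLeft_one (Q := (0 : QuadraticForm R (Fin 4 → R))) _

theorem contract_e (a : Fin 4 → R) (i : Fin 4) : contract a (e R i) = a i • 1 := by
  simpa [contract_one] using contract_e_mul a i 1

theorem e_mul_self (i : Fin 4) : e R i * e R i = 0 := ExteriorAlgebra.ι_sq_zero _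

theorem e_mul_swap (i j : Fin 4) : e R i * e R j = -(e R j * e R i) :=
  eq_neg_of_add_eq_zero_left (ExteriorAlgebra.ι_add_mul_swap _ _)

theorem e_mul_self_mul (i : Fin 4) (x : ExteriorAlgebra R (Fin 4 → R)) :
    e R i * (e R i * x) = 0 := by
  rw [← mul_assoc, e_mul_self, zero_mul]

theorem e_mul_swap_mul (i j : Fin 4) (x : ExteriorAlgebra R (Fin 4 → R)) :
    e R i * (e R j * x) = -(e R j * (e R i * x)) := by
  rw [← mul_assoc, e_mul_swap, neg_mul, mul_assoc]

theorem clifford_eq (v : V R) (η : ExteriorAlgebra R (Fin 4 → R)) :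
    clifford v η = (∑ i, v (Sum.inl i) • e R i) * η + contract (v ∘ Sum.inr) η := by
  rw [← ι_eq_sum_e]
  rfl

/-- Sorting all wedge monomials into increasing order identifies the eight coefficients with the
rows of `cliff z`; this is what fixes the signs in `skew`. -/
theorem clifford_toExterior (z : SPlus R) (v : V R) :
    clifford v (toExterior z)
      = (cliff z *ᵥ v) (Sum.inl 0) • e R 0 + (cliff z *ᵥ v) (Sum.inl 1) • e R 1
      + (cliff z *ᵥ v) (Sum.inl 2) • e R 2 + (cliff z *ᵥ v) (Sum.inl 3) • e R 3
      + (cliff z *ᵥ v) (Sum.inr 0) • (e R 1 * (e R 2 * e R 3))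
      - (cliff z *ᵥ v) (Sum.inr 1) • (e R 0 * (e R 2 * e R 3))
      + (cliff z *ᵥ v) (Sum.inr 2) • (e R 0 * (e R 1 * e R 3))
      - (cliff z *ᵥ v) (Sum.inr 3) • (e R 0 * (e R 1 * e R 2)) := by
  simp only [clifford_eq, toExterior, Fin.sum_univ_four, map_add, map_sub, map_smul, mul_assoc,
    contract_e_mul, contract_e, contract_one, add_mul, mul_add, mul_sub, smul_mul_assoc,
    mul_smul_comm, mul_one, e_mul_self, e_mul_self_mul, e_mul_swap 2 1, e_mul_swap 3 1, e_mul_swap 3 2, e_mul_swap_mul 1 0,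
    e_mul_swap_mul 2 0, e_mul_swap_mul 3 0, e_mul_swap_mul 2 1, e_mul_swap_mul 3 1,
    e_mul_swap_mul 3 2, mul_neg, mul_zero, Function.comp]
  simp only [cliff, skew, Matrix.fromBlocks_mulVec, Sum.elim_inl, Sum.elim_inr, Pi.add_apply,
    Matrix.smul_mulVec, Matrix.one_mulVec, Pi.smul_apply, smul_eq_mul, Function.comp]
  simp [Matrix.mulVec, dotProduct, Fin.sum_univ_four]
  module

theorem mem_Z_iff (z : SPlus R) (v : V R) : v ∈ Z z ↔ cliff z *ᵥ v = 0 := by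
  refine ⟨fun h => ?_, fun h => ?_⟩
  · have h : clifford v (toExterior z) = 0 := h
    rw [clifford_toExterior] at h
    -- The scalar part after one contraction reads off the linear coefficients, and after three
    -- contractions the cubic ones.
    have h1 (a) := congrArg (fun x => ExteriorAlgebra.algebraMapInv (contract a x)) h
    have h3 (a b c) := congrArg
      (fun x => ExteriorAlgebra.algebraMapInv (contract a (contract b (contract c x)))) h
    have he (i) : ExteriorAlgebra.algebraMapInv (e R i) = 0 := by
      simp [e, ExteriorAlgebra.algebraMapInv]
    simp [contract_e_mul, contract_e, contract_one, he] at h1 h3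
    have k0 := h1 (Pi.single 0 1)
    have k1 := h1 (Pi.single 1 1)
    have k2 := h1 (Pi.single 2 1)
    have k3 := h1 (Pi.single 3 1)
    have m0 := h3 (Pi.single 3 1) (Pi.single 2 1) (Pi.single 1 1)
    have m1 := h3 (Pi.single 3 1) (Pi.single 2 1) (Pi.single 0 1)
    have m2 := h3 (Pi.single 3 1) (Pi.single 1 1) (Pi.single 0 1)
    have m3 := h3 (Pi.single 2 1) (Pi.single 1 1) (Pi.single 0 1)
    simp at k0 k1 k2 k3 m0 m1 m2 m3
    funext i
    rcases i with i | i <;> fin_cases i <;> assumption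
  · change clifford v (toExterior z) = 0
    simp [clifford_toExterior, h]

end Spinor

/-! ### Clifford identities over a field of characteristic zero -/

section Field

variable {F : Type*} [Field F] [CharZero F]

theorem cliffAdj_mul_cliff_self (z : SPlus F) : cliffAdj z * cliff z = (form z z / 2) • 1 := by
  have h := cliffAdj_mul_cliff z z
  rw [← two_smul F] at h
  rw [div_eq_inv_mul, mul_smul, ← h, smul_smul, inv_mul_cancel₀ two_ne_zero, one_smul]

theorem cliff_mul_cliffAdj_self (z : SPlus F) : cliff z * cliffAdj z = (form z z / 2) • 1 := by
  have h := cliff_mul_cliffAdj z z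
  rw [← two_smul F] at h
  rw [div_eq_inv_mul, mul_smul, ← h, smul_smul, inv_mul_cancel₀ two_ne_zero, one_smul]

theorem cliffAdj_mul_cliff_self_mul (z : SPlus F) (X : Matrix Idx Idx F) :
    cliffAdj z * (cliff z * X) = (form z z / 2) • X := by
  rw [← Matrix.mul_assoc, cliffAdj_mul_cliff_self, Matrix.smul_mul, Matrix.one_mul]

theorem cliff_mul_cliffAdj_self_mul (z : SPlus F) (X : Matrix Idx Idx F) :
    cliff z * (cliffAdj z * X) = (form z z / 2) • X := by
  rw [← Matrix.mul_assoc, cliff_mul_cliffAdj_self, Matrix.smul_mul, Matrix.one_mul]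

theorem form_cliff_cliff (z : SPlus F) (v w : Idx → F) :
    form (cliff z *ᵥ v) (cliff z *ᵥ w) = form z z / 2 * form v w := by
  rw [form_cliff, Matrix.mulVec_mulVec, cliffAdj_mul_cliff_self, Matrix.smul_mulVec,
    Matrix.one_mulVec, form_smul_right]

theorem form_cliffAdj_cliffAdj (z : SPlus F) (v w : Idx → F) :
    form (cliffAdj z *ᵥ v) (cliffAdj z *ᵥ w) = form z z / 2 * form v w := by
  rw [form_cliffAdj, Matrix.mulVec_mulVec, cliff_mul_cliffAdj_self, Matrix.smul_mulVec,
    Matrix.one_mulVec, form_smul_right]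

/-- For fixed `v`, the map `z ↦ cliff z *ᵥ v` is a similitude with factor `(v, v) / 2`. It
transports an orthogonal frame of spinors to an orthogonal frame of odd spinors. -/
theorem form_cliff_apply (z w : SPlus F) (v : Idx → F) :
    form (cliff z *ᵥ v) (cliff w *ᵥ v) = form z w * form v v / 2 := by
  have h := congrArg (fun M => form v (M *ᵥ v)) (cliffAdj_mul_cliff z w)
  simp only [Matrix.add_mulVec, form_add_right, ← Matrix.mulVec_mulVec, ← form_cliff,
    Matrix.smul_mulVec, Matrix.one_mulVec, form_smul_right] at h
  rw [form_comm (cliff w *ᵥ v)] at h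
  linear_combination h / 2

end Field

/-! ### Anticommutation of orthogonal spinors -/

section Swap

variable {R : Type*} [CommRing R] {z w : SPlus R}

theorem cliffAdj_mul_cliff_swap (h : form z w = 0) :
    cliffAdj z * cliff w = -(cliffAdj w * cliff z) := by
  rw [eq_neg_iff_add_eq_zero, cliffAdj_mul_cliff, h, zero_smul]

theorem cliff_mul_cliffAdj_swap (h : form z w = 0) :
    cliff z * cliffAdj w = -(cliff w * cliffAdj z) := by
  rw [eq_neg_iff_add_eq_zero, cliff_mul_cliffAdj, h, zero_smul]

theorem cliffAdj_mul_cliff_swap_mul (h : form z w = 0) (X : Matrix Idx Idx R) :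
    cliffAdj z * (cliff w * X) = -(cliffAdj w * (cliff z * X)) := by
  rw [← Matrix.mul_assoc, cliffAdj_mul_cliff_swap h, Matrix.neg_mul, Matrix.mul_assoc]

theorem cliff_mul_cliffAdj_swap_mul (h : form z w = 0) (X : Matrix Idx Idx R) :
    cliff z * (cliffAdj w * X) = -(cliff w * (cliffAdj z * X)) := by
  rw [← Matrix.mul_assoc, cliff_mul_cliffAdj_swap h, Matrix.neg_mul, Matrix.mul_assoc]

theorem form_sum_right {ι : Type*} (s : Finset ι) (x : Idx → R) (f : ι → Idx → R) :
    form x (∑ i ∈ s, f i) = ∑ i ∈ s, form x (f i) := by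
  simp only [form_eq_dotProduct, Matrix.mulVec_sum, dotProduct_sum]

theorem form_sum_left {ι : Type*} (s : Finset ι) (x : Idx → R) (f : ι → Idx → R) :
    form (∑ i ∈ s, f i) x = ∑ i ∈ s, form (f i) x := by
  simp only [form_eq_dotProduct, sum_dotProduct]

theorem form_neg_right (x y : Idx → R) : form x (-y) = -form x y := by
  rw [← neg_one_smul R y, form_smul_right, neg_one_mul]

theorem form_neg_left (x y : Idx → R) : form (-x) y = -form x y := by
  rw [form_comm, form_neg_right, form_comm]

end Swap

/-! ### Signature (4, 4) -/

section Signature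

/-- In signature `(4, 4)` a vector orthogonal to a positive definite 4-space is negative. -/
theorem eq_zero_of_orthogonal_of_nonneg {v : Fin 4 → Idx → ℝ} {w : Idx → ℝ}
    (hpos : ∀ i, 0 < form (v i) (v i)) (ho : ∀ i j, i ≠ j → form (v i) (v j) = 0)
    (hw : ∀ i, form (v i) w = 0) (hww : 0 ≤ form w w) : w = 0 := by
  let u : (Fin 4 → ℝ) × ℝ →ₗ[ℝ] (Idx → ℝ) :=
    (Fintype.linearCombination ℝ v).coprod (LinearMap.toSpanSingleton ℝ _ w)
  -- The kernel of `f` consists of the combinations lying in the antidiagonal, a negative definite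
  -- 4-space. Five parameters against four equations force a nonzero one, whose norm is both
  -- nonnegative and nonpositive.
  let f : (Fin 4 → ℝ) × ℝ →ₗ[ℝ] (Fin 4 → ℝ) :=
    (LinearMap.funLeft ℝ ℝ Sum.inl + LinearMap.funLeft ℝ ℝ Sum.inr) ∘ₗ u
  have hu (c t) : u (c, t) = ∑ i, c i • v i + t • w := by
    simp [u, Fintype.linearCombination_apply]
  have hker : LinearMap.ker f ≠ ⊥ := f.ker_ne_bot_of_finrank_lt (by simp)
  obtain ⟨⟨c, t⟩, hct, hne⟩ := (Submodule.ne_bot_iff _).1 hker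
  have hform : form (u (c, t)) (u (c, t))
      = ∑ i, c i ^ 2 * form (v i) (v i) + t ^ 2 * form w w := by
    have h1 : form (∑ i, c i • v i) (∑ i, c i • v i) = ∑ i, c i ^ 2 * form (v i) (v i) := by
      rw [form_sum_left]
      refine Finset.sum_congr rfl fun i _ => ?_
      rw [form_sum_right, Finset.sum_eq_single i]
      · rw [form_smul_left, form_smul_right]; ring
      · intro j _ hj
        rw [form_smul_left, form_smul_right, ho i j hj.symm]; ring
      · simp
    have h2 : form (∑ i, c i • v i) w = 0 := by
      rw [form_sum_left]
      exact Finset.sum_eq_zero fun i _ => by rw [form_smul_left, hw, mul_zero]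
    rw [hu, form_add_left, form_add_right, form_add_right, h1, form_smul_right, h2,
      form_smul_left, form_comm w, h2, form_smul_left, form_smul_right]
    ring
  have hneg : form (u (c, t)) (u (c, t)) = -∑ i, 2 * u (c, t) (Sum.inl i) ^ 2 := by
    rw [form, ← Finset.sum_neg_distrib]
    refine Finset.sum_congr rfl fun i _ => ?_
    have h : u (c, t) (Sum.inl i) + u (c, t) (Sum.inr i) = 0 := congrFun hct i
    rw [eq_neg_of_add_eq_zero_right h]; ring
  have hS1 : 0 ≤ ∑ i, c i ^ 2 * form (v i) (v i) :=
    Finset.sum_nonneg fun i _ => mul_nonneg (sq_nonneg _) (hpos i).le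
  have hS2 : 0 ≤ ∑ i, 2 * u (c, t) (Sum.inl i) ^ 2 :=
    Finset.sum_nonneg fun i _ => by positivity
  have hS3 : 0 ≤ t ^ 2 * form w w := by positivity
  have hc : c = 0 := by
    have h0 : ∑ i, c i ^ 2 * form (v i) (v i) = 0 := by linarith
    rw [Finset.sum_eq_zero_iff_of_nonneg
      fun i _ => mul_nonneg (sq_nonneg _) (hpos i).le] at h0
    funext i
    simpa [(hpos i).ne'] using h0 i (Finset.mem_univ i)
  have ht : t ≠ 0 := by
    rintro rfl
    exact hne (by rw [hc]; rfl)
  have hz : ∀ i, u (c, t) (Sum.inl i) = 0 := by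
    have h0 : ∑ i, 2 * u (c, t) (Sum.inl i) ^ 2 = 0 := by linarith
    rw [Finset.sum_eq_zero_iff_of_nonneg fun i _ => by positivity] at h0
    intro i
    simpa using h0 i (Finset.mem_univ i)
  have hu0 : u (c, t) = 0 := by
    funext i
    rcases i with i | i
    · exact hz i
    · have h : u (c, t) (Sum.inl i) + u (c, t) (Sum.inr i) = 0 := congrFun hct i
      rwa [hz, zero_add] at h
  rw [hu, hc] at hu0
  simpa [ht] using hu0

/-- The anti-isometry `(a, b) ↦ (a, -b)`. -/
def flip (x : Idx → ℝ) : Idx → ℝ := Sum.elim (fun i => x (Sum.inl i)) fun i => -x (Sum.inr i)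

theorem form_flip (x y : Idx → ℝ) : form (flip x) (flip y) = -form x y := by
  simp [form, flip, Finset.sum_add_distrib]
  ring

theorem eq_zero_of_orthogonal_of_nonpos {v : Fin 4 → Idx → ℝ} {w : Idx → ℝ}
    (hneg : ∀ i, form (v i) (v i) < 0) (ho : ∀ i j, i ≠ j → form (v i) (v j) = 0)
    (hw : ∀ i, form (v i) w = 0) (hww : form w w ≤ 0) : w = 0 := by
  have h : flip w = 0 := by
    refine eq_zero_of_orthogonal_of_nonneg (v := fun i => flip (v i)) ?_ ?_ ?_ ?_
    · intro i; rw [form_flip]; linarith [hneg i]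
    · intro i j hij; rw [form_flip, ho i j hij, neg_zero]
    · intro i; rw [form_flip, hw, neg_zero]
    · rw [form_flip]; linarith
  funext i
  have := congrFun h i
  rcases i with i | i <;> simpa [flip] using this

theorem exists_orthogonal (p : Fin 4 → Idx → ℝ) : ∃ t : Idx → ℝ, t ≠ 0 ∧ ∀ i, form (p i) t = 0 := by
  let f : (Idx → ℝ) →ₗ[ℝ] (Fin 4 → ℝ) := Matrix.toLin' (Matrix.of p * swapMatrix ℝ)
  have hker : LinearMap.ker f ≠ ⊥ := f.ker_ne_bot_of_finrank_lt (by simp)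
  obtain ⟨t, ht, hne⟩ := (Submodule.ne_bot_iff _).1 hker
  refine ⟨t, hne, fun i => ?_⟩
  have := congrFun ht i
  rw [form_eq_dotProduct]
  rw [Matrix.toLin'_apply, ← Matrix.mulVec_mulVec] at this
  exact this

end Signature

/-! ### Definiteness of the fourfold Clifford product -/

section Definite

/-- A self-adjoint `C` with `C² = c²` that anticommutes with an anti-similitude `T`, and for which
`form v (C v)` does not vanish on anisotropic vectors, is definite. -/
theorem definite_of_anticommute {C T : Matrix Idx Idx ℝ} {c m : ℝ} (hc : 0 < c) (hm : m < 0)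
    (hCC : C * C = (c ^ 2) • 1) (hC : ∀ v w, form (C *ᵥ v) w = form v (C *ᵥ w))
    (hB : ∀ v, form v v ≠ 0 → form v (C *ᵥ v) ≠ 0) (hTC : T * C = -(C * T))
    (hT : ∀ v, form (T *ᵥ v) (T *ᵥ v) = m * form v v) (hTT : T * T = (-m) • 1) :
    (∀ v, v ≠ 0 → 0 < form v (C *ᵥ v)) ∨ ∀ v, v ≠ 0 → form v (C *ᵥ v) < 0 := by
  have hmul (v) : C *ᵥ (C *ᵥ v) = c ^ 2 • v := by
    rw [Matrix.mulVec_mulVec, hCC, Matrix.smul_mulVec, Matrix.one_mulVec]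
  have hTeig {v : Idx → ℝ} {μ : ℝ} (h : C *ᵥ v = μ • v) : C *ᵥ (T *ᵥ v) = (-μ) • (T *ᵥ v) := by
    have h1 := congrArg (· *ᵥ v) hTC
    simp only [Matrix.neg_mulVec, ← Matrix.mulVec_mulVec, h, Matrix.mulVec_smul] at h1
    rw [neg_smul, h1, neg_neg]
  have hTne {v} (h : v ≠ 0) : T *ᵥ v ≠ 0 := by
    intro h0
    have h1 := congrArg (· *ᵥ v) hTT
    simp only [← Matrix.mulVec_mulVec, h0, Matrix.mulVec_zero, Matrix.smul_mulVec,
      Matrix.one_mulVec] at h1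
    exact h ((smul_eq_zero.1 h1.symm).resolve_left (by linarith))
  have horth {v w} (hv : C *ᵥ v = c • v) (hw : C *ᵥ w = (-c) • w) : form v w = 0 := by
    have := hC v w
    rw [hv, hw, form_smul_left, form_smul_right] at this
    have h2 : 2 * c * form v w = 0 := by linarith
    simpa [hc.ne'] using h2
  -- the two eigenspaces do not contain vectors whose norms have the same sign
  have hsign {v w} (hv : C *ᵥ v = c • v) (hw : C *ᵥ w = (-c) • w) :
      ¬ 0 < form v v * form w w := by
    intro h
    have hv0 : form v v ≠ 0 := fun h0 => by simp [h0] at h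
    have hw0 : form w w ≠ 0 := fun h0 => by simp [h0] at h
    set μ := Real.sqrt (form v v / form w w)
    have hμ : μ ^ 2 * form w w = form v v := by
      rw [Real.sq_sqrt, div_mul_cancel₀ _ hw0]
      rw [div_nonneg_iff]
      rcases mul_pos_iff.1 h with h | h
      · exact Or.inl ⟨h.1.le, h.2.le⟩
      · exact Or.inr ⟨h.1.le, h.2.le⟩
    have hwv : form w v = 0 := by rw [form_comm, horth hv hw]
    -- The scaling `μ` equalizes the two norms. The combination then has norm `2 (v, v) ≠ 0`, while
    -- its two contributions to the pairing with `C` cancel.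
    refine hB (v + μ • w) ?_ ?_
    · simp only [form_add_left, form_add_right, form_smul_left, form_smul_right, horth hv hw, hwv]
      intro h0
      apply hv0
      linear_combination h0 / 2 - hμ / 2
    · simp only [Matrix.mulVec_add, Matrix.mulVec_smul, hv, hw, form_add_left, form_add_right,
        form_smul_left, form_smul_right, horth hv hw, hwv]
      linear_combination (-c) * hμ
  -- `T` moves `w` to the other eigenspace and reverses the sign of its norm, so opposite signs here
  -- would give equal signs across the eigenspaces.
  have hsemi {v w} (hv : C *ᵥ v = c • v) (hw : C *ᵥ w = c • w) :
      0 ≤ form v v * form w w := by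
    by_contra! h
    refine hsign hv (hTeig hw) ?_
    rw [hT]
    nlinarith
  have hdecomp (v) : v = (2 * c)⁻¹ • ((C *ᵥ v + c • v) + (c • v - C *ᵥ v)) := by
    rw [show (C *ᵥ v + c • v) + (c • v - C *ᵥ v) = (2 * c) • v by module, smul_smul,
      inv_mul_cancel₀ (by positivity), one_smul]
  have hplus (v) : C *ᵥ (C *ᵥ v + c • v) = c • (C *ᵥ v + c • v) := by
    rw [Matrix.mulVec_add, hmul, Matrix.mulVec_smul]; module
  have hminus (v) : C *ᵥ (c • v - C *ᵥ v) = (-c) • (c • v - C *ᵥ v) := by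
    rw [Matrix.mulVec_sub, hmul, Matrix.mulVec_smul]; module
  have haniso {v} (hv : C *ᵥ v = c • v) (h0 : form v v = 0) : v = 0 := by
    apply eq_zero_of_form_eq_zero
    have key {w} (hw : C *ᵥ w = c • w) : form v w = 0 := by
      by_contra hne
      have h1 (a b : ℝ) := hsemi (v := w + a • v) (w := w + b • v)
        (by rw [Matrix.mulVec_add, Matrix.mulVec_smul, hw, hv]; module)
        (by rw [Matrix.mulVec_add, Matrix.mulVec_smul, hw, hv]; module)
      have h2 (a : ℝ) : form (w + a • v) (w + a • v) = form w w + 2 * a * form v w := by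
        simp only [form_add_left, form_add_right, form_smul_left, form_smul_right, h0,
          form_comm w v]
        ring
      -- If the isotropic `v` paired nontrivially with `w`, the norm of `w + a • v` would be a
      -- nonconstant affine function of `a`. These two values of `a` make it `1` and `-1`.
      have h3 := h1 ((1 - form w w) / (2 * form v w)) ((-1 - form w w) / (2 * form v w))
      rw [h2, h2] at h3
      have h4 (a : ℝ) : form w w + 2 * ((a - form w w) / (2 * form v w)) * form v w = a := by
        field_simp
        ring
      rw [h4, h4] at h3
      norm_num at h3
    intro w
    rw [hdecomp w, form_smul_right, form_add_right, key (hplus w), horth hv (hminus w)]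
    simp
  have hB' (v) : (4 * c) * form v (C *ᵥ v)
      = form (C *ᵥ v + c • v) (C *ᵥ v + c • v) - form (c • v - C *ᵥ v) (c • v - C *ᵥ v) := by
    simp only [sub_eq_add_neg, form_add_left, form_add_right, form_smul_left, form_smul_right,
      form_neg_left, form_neg_right, form_comm (C *ᵥ v) v]
    ring
  have hsplit {v} (hv : v ≠ 0) : C *ᵥ v + c • v ≠ 0 ∨ c • v - C *ᵥ v ≠ 0 := by
    by_contra! h
    apply hv
    rw [hdecomp v, h.1, h.2, add_zero, smul_zero]
  have hTm {v} (hv : C *ᵥ v = (-c) • v) : C *ᵥ (T *ᵥ v) = c • (T *ᵥ v) := by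
    rw [hTeig hv, neg_neg]
  by_cases hp : ∃ v, C *ᵥ v = c • v ∧ 0 < form v v
  · obtain ⟨v₀, hv₀, hpos⟩ := hp
    have hP {v} (hv : C *ᵥ v = c • v) : 0 ≤ form v v := by
      have := hsemi hv hv₀
      exact nonneg_of_mul_nonneg_left this hpos
    have hP' {v} (hv : C *ᵥ v = c • v) (h : v ≠ 0) : 0 < form v v :=
      lt_of_le_of_ne (hP hv) fun h0 => h (haniso hv h0.symm)
    have hM {v} (hv : C *ᵥ v = (-c) • v) : form v v ≤ 0 := by
      have := hP (hTm hv)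
      rw [hT] at this
      nlinarith
    have hM' {v} (hv : C *ᵥ v = (-c) • v) (h : v ≠ 0) : form v v < 0 := by
      have := hP' (hTm hv) (hTne h)
      rw [hT] at this
      nlinarith
    left
    intro v hv
    have : 0 < (4 * c) * form v (C *ᵥ v) := by
      rw [hB']
      rcases hsplit hv with h | h
      · linarith [hP' (hplus v) h, hM (hminus v)]
      · linarith [hP (hplus v), hM' (hminus v) h]
    exact pos_of_mul_pos_right this (by positivity)
  · push Not at hp
    have hP' {v} (hv : C *ᵥ v = c • v) (h : v ≠ 0) : form v v < 0 :=
      lt_of_le_of_ne (hp v hv) fun h0 => h (haniso hv h0)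
    have hM {v} (hv : C *ᵥ v = (-c) • v) : 0 ≤ form v v := by
      have := hp _ (hTm hv)
      rw [hT] at this
      nlinarith
    have hM' {v} (hv : C *ᵥ v = (-c) • v) (h : v ≠ 0) : 0 < form v v := by
      have := hP' (hTm hv) (hTne h)
      rw [hT] at this
      nlinarith
    right
    intro v hv
    have : (4 * c) * form v (C *ᵥ v) < 0 := by
      rw [hB']
      rcases hsplit hv with h | h
      · linarith [hP' (hplus v) h, hM (hminus v)]
      · linarith [hp _ (hplus v), hM' (hminus v) h]
    exact (pos_iff_neg_of_mul_neg this).1 (by positivity)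

variable {p : Fin 4 → SPlus ℝ}

/-- The product of the Clifford operators of four spinors. -/
def cliffProd (p : Fin 4 → SPlus ℝ) : Matrix Idx Idx ℝ :=
  cliffAdj (p 0) * (cliff (p 1) * (cliffAdj (p 2) * cliff (p 3)))

/-- The vectors `cliff (p i) *ᵥ v` span a definite 4-space of the sign of `(v, v)`. If the pairing
vanished, the triple product `w` would be orthogonal to all four: this is the assumption for `p 0`,
and for the others two equal factors cancel and leave a pairing of distinct frame vectors. But `w`
is nonzero with norm of the same sign, which signature (4, 4) forbids. -/
theorem form_cliffProd_ne_zero (hpos : ∀ i, 0 < form (p i) (p i))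
    (ho : ∀ i j, i ≠ j → form (p i) (p j) = 0) {v : Idx → ℝ} (hv : form v v ≠ 0) :
    form v (cliffProd p *ᵥ v) ≠ 0 := by
  intro h0
  set w := cliff (p 1) *ᵥ (cliffAdj (p 2) *ᵥ (cliff (p 3) *ᵥ v)) with hw
  have hww : form w w
      = form (p 1) (p 1) / 2 * (form (p 2) (p 2) / 2 * (form (p 3) (p 3) / 2 * form v v)) := by
    rw [hw, form_cliff_cliff, form_cliffAdj_cliffAdj, form_cliff_cliff]
  have hij {i j} (h : i ≠ j) : form (cliff (p i) *ᵥ v) (cliff (p j) *ᵥ v) = 0 := by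
    rw [form_cliff_apply, ho i j h]; simp
  have hii (i) : form (cliff (p i) *ᵥ v) (cliff (p i) *ᵥ v)
      = form (p i) (p i) / 2 * form v v := form_cliff_cliff _ _ _
  have hmv : w = (cliff (p 1) * (cliffAdj (p 2) * cliff (p 3))) *ᵥ v := by
    simp only [hw, Matrix.mulVec_mulVec]
  have horth : ∀ i, form (cliff (p i) *ᵥ v) w = 0 := by
    intro i
    rw [form_cliff, hmv, Matrix.mulVec_mulVec]
    fin_cases i
    · exact h0
    · change form v ((cliffAdj (p 1) * _) *ᵥ v) = 0
      rw [cliffAdj_mul_cliff_self_mul, Matrix.smul_mulVec, form_smul_right,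
        ← Matrix.mulVec_mulVec, ← form_cliff, hij (by decide), mul_zero]
    · change form v ((cliffAdj (p 2) * _) *ᵥ v) = 0
      rw [cliffAdj_mul_cliff_swap_mul (ho 2 1 (by decide)), cliff_mul_cliffAdj_self_mul,
        Matrix.mul_smul, Matrix.neg_mulVec, form_neg_right, Matrix.smul_mulVec, form_smul_right,
        ← Matrix.mulVec_mulVec, ← form_cliff, hij (by decide), mul_zero, neg_zero]
    · change form v ((cliffAdj (p 3) * _) *ᵥ v) = 0
      rw [cliffAdj_mul_cliff_swap_mul (ho 3 1 (by decide)),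
        cliff_mul_cliffAdj_swap_mul (ho 3 2 (by decide)), cliffAdj_mul_cliff_self,
        Matrix.mul_neg, neg_neg, Matrix.mul_smul, Matrix.mul_smul, Matrix.mul_one,
        Matrix.smul_mulVec, form_smul_right,
        ← Matrix.mulVec_mulVec, ← form_cliff, hij (by decide), mul_zero]
  have h1 := hpos 1
  have h2 := hpos 2
  have h3 := hpos 3
  have hw0 : w ≠ 0 := by
    intro hw0
    have : form w w = 0 := by rw [hw0]; simp [form]
    rw [hww] at this
    simp [h1.ne', h2.ne', h3.ne', hv] at this
  apply hw0
  rcases lt_or_gt_of_ne hv with hneg | hp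
  · refine eq_zero_of_orthogonal_of_nonpos (v := fun i => cliff (p i) *ᵥ v) (fun i => ?_)
      (fun i j h => hij h) horth ?_
    · rw [hii]
      exact mul_neg_of_pos_of_neg (half_pos (hpos i)) hneg
    · rw [hww]
      exact (mul_neg_of_pos_of_neg (half_pos h1) (mul_neg_of_pos_of_neg (half_pos h2)
        (mul_neg_of_pos_of_neg (half_pos h3) hneg))).le
  · refine eq_zero_of_orthogonal_of_nonneg (v := fun i => cliff (p i) *ᵥ v) (fun i => ?_)
      (fun i j h => hij h) horth ?_
    · rw [hii]
      exact mul_pos (half_pos (hpos i)) hp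
    · rw [hww]
      positivity

/-- Reversing four anticommuting factors takes six transpositions, so the sign is `+1`.
Self-adjointness and the positive scalar square both follow from this. -/
theorem cliffProd_reverse (ho : ∀ i j, i ≠ j → form (p i) (p j) = 0) :
    cliffAdj (p 3) * (cliff (p 2) * (cliffAdj (p 1) * cliff (p 0))) = cliffProd p := by
  rw [cliffProd, cliffAdj_mul_cliff_swap (ho 1 0 (by decide)), Matrix.mul_neg, Matrix.mul_neg,
    cliff_mul_cliffAdj_swap_mul (ho 2 0 (by decide)), Matrix.mul_neg, neg_neg,
    cliffAdj_mul_cliff_swap_mul (ho 3 0 (by decide)),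
    cliffAdj_mul_cliff_swap (ho 2 1 (by decide)), Matrix.mul_neg, Matrix.mul_neg, neg_neg,
    cliff_mul_cliffAdj_swap_mul (ho 3 1 (by decide)),
    cliffAdj_mul_cliff_swap (ho 3 2 (by decide)), Matrix.mul_neg, Matrix.mul_neg, Matrix.mul_neg,
    neg_neg]

theorem cliffProd_adjoint (ho : ∀ i j, i ≠ j → form (p i) (p j) = 0) (v w : Idx → ℝ) :
    form (cliffProd p *ᵥ v) w = form v (cliffProd p *ᵥ w) := by
  nth_rewrite 1 [cliffProd]
  rw [← cliffProd_reverse ho]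
  simp only [← Matrix.mulVec_mulVec, form_cliff, form_cliffAdj]

theorem cliffProd_mul_self (ho : ∀ i j, i ≠ j → form (p i) (p j) = 0) :
    cliffProd p * cliffProd p = (form (p 0) (p 0) / 2 * (form (p 1) (p 1) / 2) *
      (form (p 2) (p 2) / 2) * (form (p 3) (p 3) / 2)) • 1 := by
  nth_rewrite 2 [← cliffProd_reverse ho]
  simp only [cliffProd, Matrix.mul_assoc, cliff_mul_cliffAdj_self_mul,
    cliffAdj_mul_cliff_self_mul, Matrix.mul_smul, cliffAdj_mul_cliff_self, smul_smul]
  congr 1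
  ring

/-- Moving `t` past the four factors gives an even sign; moving `p 0` past the three others gives an
odd one. -/
theorem cliffProd_anticommute (ho : ∀ i j, i ≠ j → form (p i) (p j) = 0) {t : SPlus ℝ}
    (ht : ∀ i, form (p i) t = 0) :
    cliffAdj (p 0) * cliff t * cliffProd p = -(cliffProd p * (cliffAdj (p 0) * cliff t)) := by
  have ht' (i) : form t (p i) = 0 := by rw [form_comm, ht]
  simp only [cliffProd, Matrix.mul_assoc]
  rw [cliff_mul_cliffAdj_swap_mul (ht' 0), Matrix.mul_neg, cliffAdj_mul_cliff_self_mul,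
    cliff_mul_cliffAdj_swap_mul (ho 3 0 (by decide)), Matrix.mul_neg,
    cliffAdj_mul_cliff_swap_mul (ho 2 0 (by decide)), neg_neg,
    cliff_mul_cliffAdj_swap_mul (ho 1 0 (by decide)), Matrix.mul_neg,
    cliffAdj_mul_cliff_self_mul, cliffAdj_mul_cliff_swap (ht 3), Matrix.mul_neg,
    cliff_mul_cliffAdj_swap_mul (ht 2), Matrix.mul_neg, Matrix.mul_neg, neg_neg,
    cliffAdj_mul_cliff_swap_mul (ht 1), neg_neg, smul_neg]

/-- A nonzero `t` orthogonal to the positive 4-space has negative norm, so `cliffAdj (p 0) * cliff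
t` is the anti-similitude required by `definite_of_anticommute`. -/
theorem cliffProd_definite (hpos : ∀ i, 0 < form (p i) (p i))
    (ho : ∀ i j, i ≠ j → form (p i) (p j) = 0) :
    (∀ v, v ≠ 0 → 0 < form v (cliffProd p *ᵥ v)) ∨
      ∀ v, v ≠ 0 → form v (cliffProd p *ᵥ v) < 0 := by
  obtain ⟨t, ht0, ht⟩ := exists_orthogonal p
  have htt : form t t < 0 := by
    by_contra! h
    exact ht0 (eq_zero_of_orthogonal_of_nonneg hpos ho ht h)
  have h0 := hpos 0
  have h1 := hpos 1
  have h2 := hpos 2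
  have h3 := hpos 3
  refine definite_of_anticommute (T := cliffAdj (p 0) * cliff t)
    (c := Real.sqrt (form (p 0) (p 0) / 2 * (form (p 1) (p 1) / 2) *
      (form (p 2) (p 2) / 2) * (form (p 3) (p 3) / 2)))
    (m := form (p 0) (p 0) / 2 * (form t t / 2)) (by positivity)
    (mul_neg_of_pos_of_neg (half_pos h0) (by linarith)) ?_ (cliffProd_adjoint ho)
    (fun v hv => form_cliffProd_ne_zero hpos ho hv) (cliffProd_anticommute ho ht) ?_ ?_
  · rw [Real.sq_sqrt (by positivity), cliffProd_mul_self ho]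
  · intro v
    rw [← Matrix.mulVec_mulVec, form_cliffAdj_cliffAdj, form_cliff_cliff, mul_assoc]
  · rw [Matrix.mul_assoc, cliff_mul_cliffAdj_swap_mul (by rw [form_comm, ht]), Matrix.mul_neg,
      cliffAdj_mul_cliff_self_mul, cliffAdj_mul_cliff_self, smul_smul, neg_smul]

end Definite

/-! ### The square root of `-d` attached to two orthogonal spinors -/

section Turn

/-- For orthogonal `h` and `s` this is a square root of `-(h, h)(s, s)` in `End V`. -/
def turn {R : Type*} [CommRing R] (h s : SPlus R) : Matrix Idx Idx R :=
  (2 : R) • (cliffAdj h * cliff s)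

theorem turn_map {R S : Type*} [CommRing R] [CommRing S] (f : R →+* S) (h s : SPlus R) :
    (turn h s).map f = turn (f ∘ h) (f ∘ s) := by
  rw [turn, turn, ← cliffAdj_map, ← cliff_map, ← Matrix.map_mul]
  ext i j
  simp [-Matrix.map_mul, map_ofNat f 2]

theorem form_turn {R : Type*} [CommRing R] {h s : SPlus R} (hs : form h s = 0) (v w : Idx → R) :
    form (turn h s *ᵥ v) w = -form v (turn h s *ᵥ w) := by
  rw [turn, Matrix.smul_mulVec, Matrix.smul_mulVec, form_smul_left, form_smul_right,
    ← Matrix.mulVec_mulVec, form_cliffAdj, form_cliff, Matrix.mulVec_mulVec,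
    cliffAdj_mul_cliff_swap (by rw [form_comm, hs]), Matrix.neg_mulVec, form_neg_right, mul_neg]

theorem turn_mul_turn {F : Type*} [Field F] [CharZero F] {h s : SPlus F} (hs : form h s = 0) :
    turn h s * turn h s = (-(form h h * form s s)) • 1 := by
  rw [turn, Matrix.smul_mul, Matrix.mul_smul, Matrix.mul_assoc,
    cliff_mul_cliffAdj_swap_mul (by rw [form_comm, hs]), Matrix.mul_neg,
    cliffAdj_mul_cliff_self_mul, cliffAdj_mul_cliff_self, smul_smul, ← neg_smul, smul_smul,
    smul_smul]
  congr 1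
  ring

theorem cliff_mul_turn {R : Type*} [CommRing R] {h s l : SPlus R} (hh : form l h = 0)
    (hs : form l s = 0) : cliff l * turn h s = (2 : R) • (cliff h * cliffAdj s * cliff l) := by
  rw [turn, Matrix.mul_smul, cliff_mul_cliffAdj_swap_mul hh, cliffAdj_mul_cliff_swap hs,
    Matrix.mul_neg, neg_neg, Matrix.mul_assoc]

/-- `cliff l` can be moved past both factors of `turn h s`, with two sign changes, until it meets
`v`. -/
theorem turn_mulVec_mem_Z {R : Type*} [CommRing R] {h s l : SPlus R} (hh : form l h = 0)
    (hs : form l s = 0) {v : V R} (hv : v ∈ Z l) : turn h s *ᵥ v ∈ Z l := by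
  rw [mem_Z_iff] at *
  rw [Matrix.mulVec_mulVec, cliff_mul_turn hh hs, Matrix.smul_mulVec, ← Matrix.mulVec_mulVec, hv,
    Matrix.mulVec_zero, smul_zero]

end Turn

/-! ### The action of `K` determined by the isotropic line -/

section Action

variable {d : ℚ}

theorem fact_sq_ne (hd : 0 < d) : Fact (∀ r : ℚ, r ^ 2 ≠ -d + 0 * r) :=
  ⟨fun r h => by nlinarith [sq_nonneg r]⟩

theorem form_ofLattice {R : Type*} [CommRing R] (v w : SPlus ℤ) :
    form (ofLattice R v) (ofLattice R w) = ((form v w : ℤ) : R) :=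
  form_map (Int.castRingHom R) v w

/-- `Z_κ` is the `√-d`-eigenspace of one of the two square roots `± turn h s` of `-d`. -/
theorem exists_sign_mem_Z_iff {h s : SPlus ℤ} (hperp : form h s = 0) (hh : 0 < form h h)
    (hs : 0 < form s s) (hd : d = ((form h h * form s s : ℤ) : ℚ)) {κ : SPlus (K d)}
    (hmem : κ ∈ Submodule.span (K d)
      ({ofLattice (K d) h, ofLattice (K d) s} : Set (SPlus (K d))))
    (hne : κ ≠ 0) (hiso : form κ κ = 0) :
    ∃ δ : ℤˣ, ∀ v : V (K d), v ∈ Z κ ↔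
      (((δ : ℤ) : K d) • turn (ofLattice (K d) h) (ofLattice (K d) s)) *ᵥ v = sqrtNeg d • v := by
  have hd0 : 0 < d := by rw [hd]; exact_mod_cast mul_pos hh hs
  have hsq0 : sqrtNeg d * sqrtNeg d = -(((form h h : ℤ) : K d) * ((form s s : ℤ) : K d)) := by
    rw [← Int.cast_mul, ← Int.cast_neg]
    ext <;> simp [sqrtNeg, QuadraticAlgebra.re_intCast, QuadraticAlgebra.im_intCast, hd]
  have := fact_sq_ne hd0
  obtain ⟨a, b, rfl⟩ := Submodule.mem_span_pair.1 hmem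
  set h' := ofLattice (K d) h with hh'
  set s' := ofLattice (K d) s with hs'
  have e1 : form h' h' = ((form h h : ℤ) : K d) := form_ofLattice h h
  have e2 : form s' s' = ((form s s : ℤ) : K d) := form_ofLattice s s
  have e3 : form h' s' = 0 := by rw [hh', hs', form_ofLattice, hperp, Int.cast_zero]
  have hdK : sqrtNeg d * sqrtNeg d = -(form h' h' * form s' s') := by
    rw [e1, e2, hsq0]
  have n1 : form h' h' ≠ 0 := by rw [e1]; exact_mod_cast hh.ne'
  have hiso' : a ^ 2 * form h' h' + b ^ 2 * form s' s' = 0 := by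
    simp only [form_add_left, form_add_right, form_smul_left, form_smul_right, e3,
      form_comm s' h'] at hiso
    linear_combination hiso
  have hb : b ≠ 0 := by
    rintro rfl
    have : a = 0 := by simpa [n1] using hiso'
    exact hne (by simp [this])
  have hsq : (a * form h' h') ^ 2 = (b * sqrtNeg d) ^ 2 := by
    linear_combination form h' h' * hiso' - b ^ 2 * hdK
  -- Since `(h, h) ≠ 0`, `cliffAdj h'` is injective, so applying it loses nothing and turns the
  -- equation of `Z κ` into one for `turn`. By `hsq` the coefficient `a (h, h)` is `± b √-d`, which
  -- determines `δ`.
  have key (v : V (K d)) : v ∈ Z (a • h' + b • s') ↔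
      (a * form h' h') • v + b • (turn h' s' *ᵥ v) = 0 := by
    have e4 : (2 : K d) • (cliffAdj h' *ᵥ (cliff (a • h' + b • s') *ᵥ v))
        = (a * form h' h') • v + b • (turn h' s' *ᵥ v) := by
      rw [cliff_add, cliff_smul, cliff_smul, turn, Matrix.mulVec_mulVec, Matrix.mul_add,
        Matrix.mul_smul, Matrix.mul_smul, cliffAdj_mul_cliff_self]
      simp only [Matrix.add_mulVec, Matrix.smul_mulVec, Matrix.one_mulVec, smul_add, smul_smul]
      congr 2 <;> ring
    rw [mem_Z_iff, ← e4]
    refine ⟨fun h => by rw [h, Matrix.mulVec_zero, smul_zero], fun h => ?_⟩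
    have h2 := congrArg (fun w => cliff h' *ᵥ w) h
    simp only [Matrix.mulVec_smul, Matrix.mulVec_zero] at h2
    rw [Matrix.mulVec_mulVec, cliff_mul_cliffAdj_self, Matrix.smul_mulVec, Matrix.one_mulVec,
      smul_smul] at h2
    exact (smul_eq_zero.1 h2).resolve_left (by simpa using n1)
  rcases sq_eq_sq_iff_eq_or_eq_neg.1 hsq with hsgn | hsgn
  · refine ⟨-1, fun v => ?_⟩
    rw [key, hsgn, mul_smul, ← smul_add, smul_eq_zero, or_iff_right hb, Units.val_neg,
      Units.val_one, Int.cast_neg, Int.cast_one, neg_one_smul, Matrix.neg_mulVec,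
      add_eq_zero_iff_neg_eq', eq_comm]
  · refine ⟨1, fun v => ?_⟩
    rw [key, hsgn, ← mul_neg, mul_smul, ← smul_add, smul_eq_zero, or_iff_right hb,
      Units.val_one, Int.cast_one, one_smul, neg_smul, neg_add_eq_zero, eq_comm]

theorem map_eq_re_add_im {A : Type*} [Ring A] [Algebra ℚ A] (ρ : K d →ₐ[ℚ] A) (x : K d) :
    ρ x = x.re • 1 + x.im • ρ (sqrtNeg d) := by
  have : x = x.re • 1 + x.im • sqrtNeg d := by
    ext <;> simp [sqrtNeg, QuadraticAlgebra.re_one, QuadraticAlgebra.im_one]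
  conv_lhs => rw [this]
  simp

/-- Every rational vector is twice the real part of its component in the `√-d`-eigenspace of `N`, so
prescribing the action through `Z κ` is the same as prescribing the image of `√-d`. -/
theorem isActionOf_iff {κ : SPlus (K d)} {N : Matrix Idx Idx ℚ} (hd : d ≠ 0)
    (hN : N * N = (-d) • 1)
    (hZ : ∀ v : V (K d), v ∈ Z κ ↔ N.map (algebraMap ℚ (K d)) *ᵥ v = sqrtNeg d • v)
    (ρ : K d →ₐ[ℚ] Matrix Idx Idx ℚ) : IsActionOf κ ρ ↔ ρ (sqrtNeg d) = N := by
  have hmap (v : V (K d)) (i) : (N.map (algebraMap ℚ (K d)) *ᵥ v) i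
      = ⟨(N *ᵥ fun j => (v j).re) i, (N *ᵥ fun j => (v j).im) i⟩ := by
    simp only [Matrix.mulVec, dotProduct, Matrix.map_apply]
    ext
    · rw [← QuadraticAlgebra.reₗ_apply, map_sum]
      simp [QuadraticAlgebra.algebraMap_eq]
    · rw [← QuadraticAlgebra.imₗ_apply, map_sum]
      simp [QuadraticAlgebra.algebraMap_eq]
  have hNN (v : V ℚ) : N *ᵥ (N *ᵥ v) = (-d) • v := by
    rw [Matrix.mulVec_mulVec, hN, Matrix.smul_mulVec, Matrix.one_mulVec]
  refine ⟨fun hρ => ?_, fun hρ x v v₁ hv₁ hv => ?_⟩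
  · apply Matrix.ext_of_mulVec_single
    intro j
    set v : V ℚ := Pi.single j 1
    -- This is the eigenprojection `(v + N v / √-d) / 2`, with `1 / √-d = -√-d / d`.
    let v₁ : V (K d) := fun i => ⟨v i / 2, -(N *ᵥ v) i / (2 * d)⟩
    have hv₁ : v₁ ∈ Z κ := by
      rw [hZ]
      funext i
      rw [hmap]
      have e1 : (fun j => (v₁ j).re) = (2⁻¹ : ℚ) • v := by funext j; simp [v₁]; ring
      have e2 : (fun j => (v₁ j).im) = (-(2 * d)⁻¹ : ℚ) • (N *ᵥ v) := by
        funext j; simp [v₁]; ring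
      rw [e1, e2, Matrix.mulVec_smul, Matrix.mulVec_smul, hNN]
      ext
      · simp [sqrtNeg, v₁]; field_simp
      · simp [sqrtNeg, v₁]; field_simp
    have := hρ (sqrtNeg d) v v₁ hv₁ (by
      funext i
      ext <;> simp [v₁, QuadraticAlgebra.algebraMap_eq])
    funext i
    have := congrArg QuadraticAlgebra.re (congrFun this i)
    simp only [v₁, QuadraticAlgebra.algebraMap_eq] at this
    rw [this]
    simp [sqrtNeg]
    field_simp
    ring
  · rw [hZ] at hv₁
    have e1 (i) := congrArg QuadraticAlgebra.re (congrFun hv₁ i)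
    have e2 (i) := congrArg QuadraticAlgebra.im (congrFun hv₁ i)
    simp only [hmap] at e1 e2
    have e0 : v = (2 : ℚ) • fun j => (v₁ j).re := by
      funext i
      have := congrArg QuadraticAlgebra.re (congrFun hv i)
      simp [QuadraticAlgebra.algebraMap_eq] at this
      rw [this]; simp; ring
    funext i
    rw [map_eq_re_add_im, hρ, e0, Matrix.mulVec_smul, Matrix.add_mulVec, Matrix.smul_mulVec,
      Matrix.smul_mulVec, Matrix.one_mulVec]
    ext
    · simp [QuadraticAlgebra.algebraMap_eq, e1, sqrtNeg]
      ring
    · simp [QuadraticAlgebra.algebraMap_eq]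
      ring

theorem existsUnique_isActionOf {κ : SPlus (K d)} {N : Matrix Idx Idx ℚ} (hd : d ≠ 0)
    (hN : N * N = (-d) • 1)
    (hZ : ∀ v : V (K d), v ∈ Z κ ↔ N.map (algebraMap ℚ (K d)) *ᵥ v = sqrtNeg d • v) :
    ∃! ρ : K d →ₐ[ℚ] Matrix Idx Idx ℚ, IsActionOf κ ρ := by
  simp only [isActionOf_iff hd hN hZ]
  refine ⟨QuadraticAlgebra.lift ⟨N, by rw [hN]; simp⟩, ?_, ?_⟩
  · simp [sqrtNeg]
  · intro ρ hρ
    apply QuadraticAlgebra.algHom_ext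
    change ρ (sqrtNeg d) = _
    simp [hρ]

end Action

/-! ### `Z l` as an isotropic subspace and as a Hodge structure -/

section Isotropic

theorem cliffAdj_mulVec_mem_Z {F : Type*} [Field F] [CharZero F] {l : SPlus F}
    (hl : form l l = 0) (w : Idx → F) : cliffAdj l *ᵥ w ∈ Z l := by
  rw [mem_Z_iff, Matrix.mulVec_mulVec, cliff_mul_cliffAdj_self, hl]
  simp

/-- Insert the Clifford relation of `l` and `m` between `v` and `w`: in one term `cliff l` kills
`v`, in the other its adjoint moves over and kills `w`. -/
theorem form_eq_zero_of_mem_Z {F : Type*} [Field F] {l m : SPlus F} (hlm : form l m ≠ 0)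
    {v w : V F} (hv : v ∈ Z l) (hw : w ∈ Z l) : form v w = 0 := by
  rw [mem_Z_iff] at hv hw
  have h := congrArg (fun M => form (M *ᵥ v) w) (cliffAdj_mul_cliff l m)
  simp only [Matrix.add_mulVec, form_add_left, ← Matrix.mulVec_mulVec, hv, Matrix.mulVec_zero,
    form_cliffAdj, hw, Matrix.smul_mulVec, Matrix.one_mulVec, form_smul_left] at h
  have h0 (x : Idx → F) : form x 0 = 0 := by simp [form]
  have h0' (x : Idx → F) : form 0 x = 0 := by simp [form]
  rw [h0, h0', add_zero] at h
  exact (mul_eq_zero.1 h.symm).resolve_left hlm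

theorem form_swapMatrix_mulVec {R : Type*} [CommRing R] (x y : Idx → R) :
    form (swapMatrix R *ᵥ x) y = x ⬝ᵥ y := by
  rw [form_comm, form_eq_dotProduct, Matrix.mulVec_mulVec, swapMatrix_mul_self,
    Matrix.one_mulVec, dotProduct_comm]

/-- `Z l` contains the image of `cliffAdj l`, and the orthogonal of that image is the kernel of
`cliff l`. -/
theorem swapMatrix_mulVec_mem_Z {l : SPlus ℂ} (hl : form l l = 0) {φ : Idx → ℂ}
    (hφ : φ ∈ annihilator (Z l)) : swapMatrix ℂ *ᵥ φ ∈ Z l := by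
  rw [mem_Z_iff]
  refine eq_zero_of_form_eq_zero fun w => ?_
  rw [form_cliff, form_swapMatrix_mulVec]
  exact hφ _ (cliffAdj_mulVec_mem_Z hl w)

theorem star_mulVec_map {ι : Type*} [Fintype ι] (M : Matrix ι ι ℂ) (v : ι → ℂ) :
    star (M *ᵥ v) = M.map (starRingEnd ℂ) *ᵥ star v := by
  funext i
  simp [Matrix.mulVec, dotProduct]

theorem conjSubspace_Z (l : SPlus ℂ) : conjSubspace (Z l) = Z (star l) := by
  ext v
  change star v ∈ Z l ↔ _
  rw [mem_Z_iff, mem_Z_iff, ← star_eq_zero, star_mulVec_map, star_star, cliff_map]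
  rfl

theorem form_star_star (x y : Idx → ℂ) : form (star x) (star y) = star (form x y) :=
  form_map (starRingEnd ℂ) x y

/-- Divided by `(l, l̄)`, the Clifford relation of `l` and `l̄` writes the identity as a sum of maps
into `Z l` and `Z l̄`; it also shows that a vector in both is zero. -/
theorem isCompl_Z_conjSubspace {l : SPlus ℂ} (hl : form l l = 0) (hl' : form l (star l) ≠ 0) :
    IsCompl (Z l) (conjSubspace (Z l)) := by
  rw [conjSubspace_Z]
  have hid (v : V ℂ) := congrArg (fun M => M *ᵥ v) (cliffAdj_mul_cliff l (star l))
  simp only [Matrix.add_mulVec, ← Matrix.mulVec_mulVec, Matrix.smul_mulVec,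
    Matrix.one_mulVec] at hid
  have hls : form (star l) (star l) = 0 := by rw [form_star_star, hl, star_zero]
  refine isCompl_iff.2 ⟨Submodule.disjoint_def.2 fun v h1 h2 => ?_,
    codisjoint_iff.2 (eq_top_iff.2 fun v _ => ?_)⟩
  · have h := hid v
    rw [(mem_Z_iff _ _).1 h1, (mem_Z_iff _ _).1 h2, Matrix.mulVec_zero, Matrix.mulVec_zero,
      add_zero] at h
    exact (smul_eq_zero.1 h.symm).resolve_left hl'
  · have hv : v = (form l (star l))⁻¹ • (cliffAdj l *ᵥ cliff (star l) *ᵥ v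
        + cliffAdj (star l) *ᵥ cliff l *ᵥ v) := by
      rw [hid, smul_smul, inv_mul_cancel₀ hl', one_smul]
    rw [hv]
    exact Submodule.smul_mem _ _ (Submodule.add_mem_sup (cliffAdj_mulVec_mem_Z hl _)
      (cliffAdj_mulVec_mem_Z hls _))

end Isotropic

/-! ### The class of the form `E` -/

section Omega

variable {d : ℚ} {ρ : K d →ₐ[ℚ] Matrix Idx Idx ℚ} {N : Matrix Idx Idx ℚ}

theorem form_single_swap {R : Type*} [CommRing R] (x : Idx → R) (j : Idx) :
    form x (Pi.single j.swap 1) = x j := by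
  rcases j with j | j <;> simp [form, Pi.single_apply]

theorem swapMatrix_mul_apply {R : Type*} [CommRing R] (M : Matrix Idx Idx R) (i j : Idx) :
    (swapMatrix R * M) i j = M i.swap j := by
  rcases i with i | i <;>
    simp [swapMatrix, Matrix.mul_apply, Matrix.one_apply, Fintype.sum_sum_type]

theorem mul_swapMatrix_apply {R : Type*} [CommRing R] (M : Matrix Idx Idx R) (i j : Idx) :
    (M * swapMatrix R) i j = M i j.swap := by
  rcases j with j | j <;>
    simp [swapMatrix, Matrix.mul_apply, Matrix.one_apply, Fintype.sum_sum_type]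

theorem form_mulVec_single {R : Type*} [CommRing R] (N : Matrix Idx Idx R) (i j : Idx) :
    form (N *ᵥ Pi.single i.swap 1) (Pi.single j.swap 1) = N j i.swap := by
  rw [form_single_swap, Matrix.mulVec_single_one]
  rfl

theorem omegaK_eq (hρ : ρ (sqrtNeg d) = N) : omegaK ρ = swapMatrix ℚ * Nᵀ := by
  ext i j
  rw [swapMatrix_mul_apply, Matrix.transpose_apply, omegaK, Matrix.of_apply, formE, hρ,
    form_mulVec_single]

theorem swapMatrix_mul_transpose {R : Type*} [CommRing R] {N : Matrix Idx Idx R}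
    (hN : ∀ v w, form (N *ᵥ v) w = -form v (N *ᵥ w)) :
    swapMatrix R * Nᵀ = -(N * swapMatrix R) := by
  ext i j
  rw [swapMatrix_mul_apply, Matrix.neg_apply, mul_swapMatrix_apply, Matrix.transpose_apply]
  have h := form_mulVec_single N i j
  rw [hN, form_comm, form_mulVec_single N j i] at h
  exact h.symm

theorem dotProduct_omegaK {R : Type*} [CommRing R] (N : Matrix Idx Idx R) (φ ψ : Idx → R) :
    φ ⬝ᵥ (swapMatrix R * Nᵀ) *ᵥ ψ
      = form (N *ᵥ swapMatrix R *ᵥ φ) (swapMatrix R *ᵥ ψ) := by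
  rw [form_comm, form_swapMatrix_mulVec, ← Matrix.dotProduct_transpose_mulVec (A := _ * _)]
  rw [Matrix.transpose_mul, Matrix.transpose_transpose, swapMatrix_transpose,
    ← Matrix.mulVec_mulVec]

/-- Skewness of `N` makes the adjoint of `ρ x` the action of the conjugate of `x`, so the norm of
`x` factors out. -/
theorem map_mul_omegaK_mul (hρ : ρ (sqrtNeg d) = N) (hNN : N * N = (-d) • 1)
    (hN : swapMatrix ℚ * Nᵀ = -(N * swapMatrix ℚ)) (x : K d) :
    ρ x * omegaK ρ * (ρ x)ᵀ = QuadraticAlgebra.norm x • omegaK ρ := by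
  have h1 : swapMatrix ℚ * (ρ x)ᵀ = (x.re • 1 - x.im • N) * swapMatrix ℚ := by
    rw [map_eq_re_add_im, hρ, Matrix.transpose_add, Matrix.transpose_smul, Matrix.transpose_smul,
      Matrix.transpose_one, Matrix.mul_add, Matrix.mul_smul, Matrix.mul_smul, hN, Matrix.sub_mul,
      Matrix.smul_mul, Matrix.smul_mul, Matrix.mul_one, Matrix.one_mul]
    module
  have h2 : ρ x * N * (x.re • 1 - x.im • N) = QuadraticAlgebra.norm x • N := by
    rw [map_eq_re_add_im, hρ, QuadraticAlgebra.norm_def]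
    simp only [Matrix.add_mul, Matrix.mul_sub, Matrix.smul_mul, Matrix.mul_smul, Matrix.mul_one,
      Matrix.one_mul, hNN]
    module
  rw [omegaK_eq hρ, hN, Matrix.mul_neg, Matrix.neg_mul, Matrix.mul_assoc, Matrix.mul_assoc, h1,
    ← Matrix.mul_assoc, ← Matrix.mul_assoc, h2, Matrix.smul_mul, smul_neg]

end Omega

/-! ### Eigenvalue multiplicities on `H^{1,0}` -/

section Eigenspaces

theorem finrank_le_of_injOn {ι : Type*} [Fintype ι] {E E' : Submodule ℂ (ι → ℂ)} (T : (ι → ℂ) →ₗ[ℂ] (ι → ℂ))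
    (hT : Function.Injective T) (h : ∀ v ∈ E, T v ∈ E') :
    Module.finrank ℂ E ≤ Module.finrank ℂ E' :=
  LinearMap.finrank_le_finrank_of_injective (f := T.restrict h)
    fun _ _ hab => Subtype.ext (hT (congrArg Subtype.val hab))

variable {ι : Type*} [Fintype ι] [DecidableEq ι] {d : ℚ} {ρ : K d →ₐ[ℚ] Matrix ι ι ℚ}
  {N : Matrix ι ι ℚ} {H : Submodule ℂ (ι → ℂ)}

theorem complexify_map_mulVec (hρ : ρ (sqrtNeg d) = N) (x : K d) (v : ι → ℂ) :
    complexify (ρ x) *ᵥ v = (x.re : ℂ) • v + (x.im : ℂ) • (complexify N *ᵥ v) := by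
  have : complexify (ρ x) = (x.re : ℂ) • 1 + (x.im : ℂ) • complexify N := by
    rw [map_eq_re_add_im, hρ]
    ext i j
    by_cases hij : i = j <;> simp [complexify, hij]
  rw [this, Matrix.add_mulVec, Matrix.smul_mulVec, Matrix.smul_mulVec, Matrix.one_mulVec]

theorem mem_eigenIn_iff (hρ : ρ (sqrtNeg d) = N) {x : K d} (hx : x.im ≠ 0) {μ : ℂ} {v : ι → ℂ} :
    v ∈ eigenIn H (ρ x) (x.re + x.im * μ) ↔ v ∈ H ∧ complexify N *ᵥ v = μ • v := by
  rw [eigenIn, Submodule.mem_inf, Module.End.mem_eigenspace_iff, Matrix.toLin'_apply,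
    complexify_map_mulVec hρ, add_smul, add_right_inj, mul_smul]
  rw [(smul_right_injective _ (by exact_mod_cast hx : (x.im : ℂ) ≠ 0)).eq_iff]

/-- `N` is diagonalizable on `H` because its square is a nonzero scalar, and the injective `T` maps
each eigenspace into the other, which bounds the dimensions both ways. -/
theorem eigenIn_sup_and_finrank (hρ : ρ (sqrtNeg d) = N) (hd : 0 < d) (hNN : N * N = (-d) • 1)
    (hNH : ∀ v ∈ H, complexify N *ᵥ v ∈ H) {T : Matrix ι ι ℂ} (hTH : ∀ v ∈ H, T *ᵥ v ∈ H)
    (hT : Function.Injective T.mulVec) (hTN : T * complexify N = -(complexify N * T))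
    {x : K d} (hx : x.im ≠ 0) :
    eigenIn H (ρ x) (embed d x) ⊔ eigenIn H (ρ x) (embed d (star x)) = H ∧
    Module.finrank ℂ (eigenIn H (ρ x) (embed d x))
      = Module.finrank ℂ (eigenIn H (ρ x) (embed d (star x))) := by
  set μ : ℂ := (Real.sqrt (d : ℝ) : ℂ) * Complex.I with hμ
  have hμμ : μ * μ = -d := by
    have : ((Real.sqrt (d : ℝ) : ℂ)) * (Real.sqrt (d : ℝ) : ℂ) = d := by
      rw [← Complex.ofReal_mul, Real.mul_self_sqrt (by exact_mod_cast hd.le)]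
      simp
    rw [hμ]
    linear_combination (Real.sqrt (d : ℝ) : ℂ) ^ 2 * Complex.I_mul_I - this
  have hμ0 : μ ≠ 0 := by
    rintro h
    rw [h, mul_zero, eq_comm, neg_eq_zero] at hμμ
    exact hd.ne' (by exact_mod_cast hμμ)
  have h1 : embed d x = x.re + x.im * μ := rfl
  have h2 : embed d (star x) = x.re + x.im * (-μ) := by
    rw [embed, ← hμ]
    simp
  have hNNc (v : ι → ℂ) : complexify N *ᵥ (complexify N *ᵥ v) = (μ * μ) • v := by
    have : complexify N * complexify N = (μ * μ) • 1 := by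
      rw [complexify, ← Matrix.map_mul, hNN, hμμ]
      ext i j
      by_cases hij : i = j <;> simp [hij]
    rw [Matrix.mulVec_mulVec, this, Matrix.smul_mulVec, Matrix.one_mulVec]
  have hTv {ν : ℂ} {v : ι → ℂ} (hv : v ∈ H ∧ complexify N *ᵥ v = ν • v) :
      T *ᵥ v ∈ H ∧ complexify N *ᵥ (T *ᵥ v) = (-ν) • (T *ᵥ v) := by
    refine ⟨hTH v hv.1, ?_⟩
    have := congrArg (· *ᵥ v) hTN
    simp only [Matrix.neg_mulVec, ← Matrix.mulVec_mulVec, hv.2, Matrix.mulVec_smul] at this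
    rw [neg_smul, this, neg_neg]
  rw [h1, h2]
  refine ⟨le_antisymm (sup_le inf_le_left inf_le_left) fun v hv => ?_, le_antisymm ?_ ?_⟩
  · have hdec : v = ((2 : ℂ)⁻¹ • v + (2 * μ)⁻¹ • (complexify N *ᵥ v))
        + ((2 : ℂ)⁻¹ • v - (2 * μ)⁻¹ • (complexify N *ᵥ v)) := by module
    have hm := Submodule.smul_mem H (2 : ℂ)⁻¹ hv
    have hm' := Submodule.smul_mem H (2 * μ)⁻¹ (hNH v hv)
    rw [hdec]
    refine Submodule.add_mem_sup ((mem_eigenIn_iff hρ hx).2 ⟨add_mem hm hm', ?_⟩)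
      ((mem_eigenIn_iff hρ hx).2 ⟨sub_mem hm hm', ?_⟩)
    · simp only [Matrix.mulVec_add, Matrix.mulVec_smul, hNNc, smul_add, smul_smul]
      rw [add_comm]
      congr 2 <;> field_simp
    · simp only [Matrix.mulVec_sub, Matrix.mulVec_smul, hNNc, smul_sub, smul_smul]
      have e1 : (2 * μ)⁻¹ * (μ * μ) = μ * 2⁻¹ := by field_simp
      have e2 : -μ * (2 * μ)⁻¹ = -2⁻¹ := by field_simp
      rw [e1, e2]
      module
  · refine finrank_le_of_injOn (Matrix.mulVecLin T) hT fun v hv => ?_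
    rw [mem_eigenIn_iff hρ hx] at hv ⊢
    exact hTv hv
  · refine finrank_le_of_injOn (Matrix.mulVecLin T) hT fun v hv => ?_
    rw [mem_eigenIn_iff hρ hx] at hv ⊢
    simpa using hTv hv

end Eigenspaces

/-! ### The real positive 4-space of a period -/

section Period

/-- The real part of a complex vector. -/
def rePart (u : Idx → ℂ) : Idx → ℝ := fun i => (u i).re

/-- The imaginary part of a complex vector. -/
def imPart (u : Idx → ℂ) : Idx → ℝ := fun i => (u i).im

theorem eq_re_add_im (u : Idx → ℂ) :
    u = Complex.ofRealHom ∘ rePart u + Complex.I • (Complex.ofRealHom ∘ imPart u) := by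
  funext i
  simp [rePart, imPart, mul_comm Complex.I, Complex.re_add_im]

theorem form_re (u w : Idx → ℂ) :
    (form u w).re = form (rePart u) (rePart w) - form (imPart u) (imPart w) := by
  simp only [form, rePart, imPart, Complex.re_sum, Complex.add_re, Complex.mul_re,
    ← Finset.sum_sub_distrib]
  exact Finset.sum_congr rfl fun i _ => by ring

theorem form_im (u w : Idx → ℂ) :
    (form u w).im = form (rePart u) (imPart w) + form (imPart u) (rePart w) := by
  simp only [form, rePart, imPart, Complex.im_sum, Complex.add_im, Complex.mul_im,
    ← Finset.sum_add_distrib]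
  exact Finset.sum_congr rfl fun i _ => by ring

theorem rePart_mulVec (M : Matrix Idx Idx ℝ) (u : Idx → ℂ) :
    rePart (M.map Complex.ofRealHom *ᵥ u) = M *ᵥ rePart u := by
  funext i
  simp [rePart, Matrix.mulVec, dotProduct]

theorem imPart_mulVec (M : Matrix Idx Idx ℝ) (u : Idx → ℂ) :
    imPart (M.map Complex.ofRealHom *ᵥ u) = M *ᵥ imPart u := by
  funext i
  simp [imPart, Matrix.mulVec, dotProduct]

theorem re_form_star_mulVec (M : Matrix Idx Idx ℝ) (u : Idx → ℂ) :
    (form (star u) (M.map Complex.ofRealHom *ᵥ u)).re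
      = form (rePart u) (M *ᵥ rePart u) + form (imPart u) (M *ᵥ imPart u) := by
  rw [form_re, rePart_mulVec, imPart_mulVec]
  have h1 : rePart (star u) = rePart u := rfl
  have h2 : imPart (star u) = -imPart u := rfl
  rw [h1, h2, form_neg_left, sub_neg_eq_add]

/-- The real positive definite 4-space spanned by `h`, `s` and the real and imaginary parts
of `ℓ`. -/
def positiveFrame (h s : SPlus ℤ) (l : SPlus ℂ) : Fin 4 → SPlus ℝ :=
  ![ofLattice ℝ h, ofLattice ℝ s, rePart l, imPart l]

variable {h s : SPlus ℤ} {l : SPlus ℂ}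

theorem rePart_ofLattice (v : SPlus ℤ) : rePart (ofLattice ℂ v) = ofLattice ℝ v := by
  funext i
  simp [rePart, ofLattice]

theorem imPart_ofLattice (v : SPlus ℤ) : imPart (ofLattice ℂ v) = 0 := by
  funext i
  simp [imPart, ofLattice]

theorem form_rePart_self (hl : l ∈ periodDomain h s) :
    0 < form (rePart l) (rePart l) ∧ form (imPart l) (imPart l) = form (rePart l) (rePart l)
      ∧ form (rePart l) (imPart l) = 0 := by
  obtain ⟨h1, h2, -, -⟩ := hl
  have e1 := congrArg Complex.re h1
  have e2 := congrArg Complex.im h1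
  rw [form_re, Complex.zero_re] at e1
  rw [form_im, Complex.zero_im, form_comm (imPart l)] at e2
  rw [form_re] at h2
  have h3 : rePart (star l) = rePart l := rfl
  have h4 : imPart (star l) = -imPart l := rfl
  rw [h3, h4, form_neg_right] at h2
  refine ⟨?_, ?_, ?_⟩ <;> linarith

theorem positiveFrame_pos (hh : 0 < form h h) (hs : 0 < form s s) (hl : l ∈ periodDomain h s)
    (i : Fin 4) : 0 < form (positiveFrame h s l i) (positiveFrame h s l i) := by
  obtain ⟨h1, h2, -⟩ := form_rePart_self hl
  fin_cases i
  · change 0 < form (ofLattice ℝ h) (ofLattice ℝ h)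
    rw [form_ofLattice]; exact_mod_cast hh
  · change 0 < form (ofLattice ℝ s) (ofLattice ℝ s)
    rw [form_ofLattice]; exact_mod_cast hs
  · exact h1
  · change 0 < form (imPart l) (imPart l)
    rwa [h2]

theorem form_rePart_ofLattice {v : SPlus ℤ} (hv : form l (ofLattice ℂ v) = 0) :
    form (rePart l) (ofLattice ℝ v) = 0 ∧ form (imPart l) (ofLattice ℝ v) = 0 := by
  have e1 := congrArg Complex.re hv
  have e2 := congrArg Complex.im hv
  have h0 (x : Idx → ℝ) : form x 0 = 0 := by simp [form]
  rw [form_re, imPart_ofLattice, rePart_ofLattice, h0, sub_zero] at e1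
  rw [form_im, imPart_ofLattice, rePart_ofLattice, h0, zero_add] at e2
  exact ⟨e1, e2⟩

theorem positiveFrame_orthogonal (hperp : form h s = 0) (hl : l ∈ periodDomain h s)
    (i j : Fin 4) (hij : i ≠ j) : form (positiveFrame h s l i) (positiveFrame h s l j) = 0 := by
  obtain ⟨-, -, h3⟩ := form_rePart_self hl
  have e0 : form (ofLattice ℝ h) (ofLattice ℝ s) = 0 := by rw [form_ofLattice, hperp, Int.cast_zero]
  obtain ⟨e1, e2⟩ := form_rePart_ofLattice hl.2.2.1
  obtain ⟨e3, e4⟩ := form_rePart_ofLattice hl.2.2.2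
  have key : ∀ i j : Fin 4, i < j →
      form (positiveFrame h s l i) (positiveFrame h s l j) = 0 := by
    intro i j hij
    fin_cases i <;> fin_cases j <;> first | exact absurd hij (by decide) | skip
    · exact e0
    · exact (form_comm _ _).trans e1
    · exact (form_comm _ _).trans e2
    · exact (form_comm _ _).trans e3
    · exact (form_comm _ _).trans e4
    · exact h3
  rcases lt_or_gt_of_ne hij with h | h
  · exact key i j h
  · rw [form_comm]; exact key j i h

theorem ofRealHom_comp_ofLattice (v : SPlus ℤ) :
    Complex.ofRealHom ∘ ofLattice ℝ v = ofLattice ℂ v := by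
  funext i
  simp [ofLattice]

/-- On `Z_ℓ` the operator `turn h s` is a multiple of the definite operator `cliffProd`. -/
theorem cliffProd_mulVec_of_mem_Z {u : V ℂ} (hu : u ∈ Z l) :
    (4 : ℂ) • ((cliffProd (positiveFrame h s l)).map Complex.ofRealHom *ᵥ u)
      = (Complex.I * (form (rePart l) (rePart l) : ℝ))
        • (turn (ofLattice ℂ h) (ofLattice ℂ s) *ᵥ u) := by
  have hmap : (cliffProd (positiveFrame h s l)).map Complex.ofRealHom
      = cliffAdj (ofLattice ℂ h) * cliff (ofLattice ℂ s)
        * (cliffAdj (Complex.ofRealHom ∘ rePart l) * cliff (Complex.ofRealHom ∘ imPart l)) := by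
    simp only [cliffProd, positiveFrame, Matrix.map_mul, cliffAdj_map, cliff_map, Matrix.cons_val,
      ofRealHom_comp_ofLattice, Matrix.mul_assoc]
  set x := Complex.ofRealHom ∘ rePart l with hx
  set y := Complex.ofRealHom ∘ imPart l with hy
  have hxx : form x x = (form (rePart l) (rePart l) : ℝ) := form_map Complex.ofRealHom _ _
  rw [mem_Z_iff, eq_re_add_im l, ← hx, ← hy, cliff_add, cliff_smul, Matrix.add_mulVec,
    Matrix.smul_mulVec] at hu
  have h1 := congrArg (cliffAdj x *ᵥ ·) hu
  simp only [Matrix.mulVec_add, Matrix.mulVec_smul, Matrix.mulVec_mulVec, cliffAdj_mul_cliff_self,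
    Matrix.smul_mulVec, Matrix.one_mulVec, Matrix.mulVec_zero] at h1
  -- For `l = x + i y`, this is `cliffAdj x` applied to `cliff l *ᵥ u = 0`.
  have h2 : (cliffAdj x * cliff y) *ᵥ u = (Complex.I * (form x x / 2)) • u := by
    have := congrArg (Complex.I • ·) h1
    simp only [smul_add, smul_smul, Complex.I_mul_I, smul_zero, neg_smul, one_smul] at this
    rw [← sub_eq_add_neg, sub_eq_zero] at this
    exact this.symm
  rw [hmap, ← Matrix.mulVec_mulVec, h2, turn, Matrix.mulVec_smul, Matrix.smul_mulVec, smul_smul,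
    smul_smul, ← hxx]
  congr 1
  ring

end Period

/-! ### The polarization and the Weil type condition -/

section Polarization

variable {d : ℚ} {h s : SPlus ℤ} {l : SPlus ℂ} {δ : ℤˣ} {ρ : K d →ₐ[ℚ] Matrix Idx Idx ℚ}

/-- The action of `√-d` on the lattice `V`. -/
def signedTurn (δ : ℤˣ) (h s : SPlus ℤ) : Matrix Idx Idx ℤ := (δ : ℤ) • turn h s

theorem signedTurn_map {R : Type*} [CommRing R] (δ : ℤˣ) (h s : SPlus ℤ) :
    (signedTurn δ h s).map (Int.castRingHom R)
      = ((δ : ℤ) : R) • turn (ofLattice R h) (ofLattice R s) := by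
  have : (turn h s).map (Int.castRingHom R) = turn (ofLattice R h) (ofLattice R s) :=
    turn_map _ _ _
  rw [← this, signedTurn]
  ext i j
  simp [-zsmul_eq_mul]

theorem signedTurn_map_map {F S : Type*} [CommRing F] [CommRing S] (f : F →+* S) (δ : ℤˣ)
    (h s : SPlus ℤ) : ((signedTurn δ h s).map (Int.castRingHom F)).map f
      = (signedTurn δ h s).map (Int.castRingHom S) := by
  ext i j
  simp

theorem form_signedTurn_map {R : Type*} [CommRing R] (hperp : form h s = 0) (v w : Idx → R) :
    form ((signedTurn δ h s).map (Int.castRingHom R) *ᵥ v) w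
      = -form v ((signedTurn δ h s).map (Int.castRingHom R) *ᵥ w) := by
  rw [signedTurn_map, Matrix.smul_mulVec, Matrix.smul_mulVec, form_smul_left, form_smul_right,
    form_turn (by rw [form_ofLattice, hperp, Int.cast_zero]), mul_neg]

theorem signedTurn_map_mul_self (hperp : form h s = 0)
    (hd : d = ((form h h * form s s : ℤ) : ℚ)) :
    (signedTurn δ h s).map (Int.castRingHom ℚ) * (signedTurn δ h s).map (Int.castRingHom ℚ)
      = (-d) • 1 := by
  have hδ : ((δ : ℤ) : ℚ) * ((δ : ℤ) : ℚ) = 1 := by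
    rw [← Int.cast_mul, ← Units.val_mul, Int.units_mul_self, Units.val_one, Int.cast_one]
  rw [signedTurn_map, Matrix.smul_mul, Matrix.mul_smul, smul_smul, hδ, one_smul,
    turn_mul_turn (by rw [form_ofLattice, hperp, Int.cast_zero]), form_ofLattice, form_ofLattice,
    ← Int.cast_mul, hd]

/-- `cliffAdj h * cliff t` for a real `t` orthogonal to `positiveFrame h s ℓ` exchanges the two
eigenspaces of `turn h s` in `Z_ℓ`. -/
theorem exists_anticommute (hperp : form h s = 0) (hh : 0 < form h h) (hs : 0 < form s s)
    (hl : l ∈ periodDomain h s) :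
    ∃ T : Matrix Idx Idx ℂ, (∀ v ∈ Z l, T *ᵥ v ∈ Z l) ∧ Function.Injective T.mulVec ∧
      T * turn (ofLattice ℂ h) (ofLattice ℂ s) = -(turn (ofLattice ℂ h) (ofLattice ℂ s) * T) := by
  obtain ⟨t, ht0, ht⟩ := exists_orthogonal (positiveFrame h s l)
  have htt : form t t ≠ 0 := fun h0 => ht0 (eq_zero_of_orthogonal_of_nonneg
    (positiveFrame_pos hh hs hl) (positiveFrame_orthogonal hperp hl) ht h0.ge)
  set t' : SPlus ℂ := Complex.ofRealHom ∘ t with ht'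
  have hfm (x y : Idx → ℝ) : form (Complex.ofRealHom ∘ x) (Complex.ofRealHom ∘ y)
      = (form x y : ℝ) := form_map _ _ _
  have e0 : form (ofLattice ℂ h) t' = 0 := by
    have := ht 0
    rw [← ofRealHom_comp_ofLattice, hfm]
    exact_mod_cast this
  have e1 : form (ofLattice ℂ s) t' = 0 := by
    have := ht 1
    rw [← ofRealHom_comp_ofLattice, hfm]
    exact_mod_cast this
  have e2 : form l t' = 0 := by
    have h2 : form (rePart l) t = 0 := ht 2
    have h3 : form (imPart l) t = 0 := ht 3
    rw [eq_re_add_im l, form_add_left, form_smul_left, hfm, hfm, h2, h3]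
    simp
  have e3 : form t' t' ≠ 0 := by
    rw [hfm]
    exact_mod_cast htt
  have e4 : form (ofLattice ℂ h) (ofLattice ℂ h) ≠ 0 := by
    rw [form_ofLattice]
    exact_mod_cast hh.ne'
  have e5 : form (ofLattice ℂ h) (ofLattice ℂ s) = 0 := by
    rw [form_ofLattice, hperp, Int.cast_zero]
  have hTT : turn (ofLattice ℂ h) t' * turn (ofLattice ℂ h) t'
      = (-(form (ofLattice ℂ h) (ofLattice ℂ h) * form t' t')) • 1 := turn_mul_turn e0
  refine ⟨turn (ofLattice ℂ h) t', fun v => turn_mulVec_mem_Z hl.2.2.1 e2, fun v w hvw => ?_, ?_⟩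
  · have := congrArg (turn (ofLattice ℂ h) t' *ᵥ ·) hvw
    simp only [Matrix.mulVec_mulVec, hTT, Matrix.smul_mulVec, Matrix.one_mulVec] at this
    exact smul_right_injective _ (neg_ne_zero.2 (mul_ne_zero e4 e3)) this
  · simp only [turn, Matrix.smul_mul, Matrix.mul_smul, Matrix.mul_assoc]
    rw [cliff_mul_cliffAdj_swap_mul ((form_comm t' (ofLattice ℂ h)).trans e0),
      cliff_mul_cliffAdj_swap_mul ((form_comm (ofLattice ℂ s) (ofLattice ℂ h)).trans e5), Matrix.mul_neg, Matrix.mul_neg,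
      cliffAdj_mul_cliff_self_mul, cliffAdj_mul_cliff_self_mul, cliffAdj_mul_cliff_swap e1]
    simp

theorem isPolarization_omegaK (hperp : form h s = 0) (hh : 0 < form h h) (hs : 0 < form s s)
    (hl : l ∈ periodDomain h s)
    (hρ : ρ (sqrtNeg d) = (signedTurn δ h s).map (Int.castRingHom ℚ)) :
    ∃ ε : ℤˣ, IsPolarization (Z l) (((ε : ℤ) : ℚ) • omegaK ρ) := by
  set N := signedTurn δ h s with hN
  have hls : form l (star l) ≠ 0 := fun h0 => by
    have := hl.2.1
    rw [h0] at this
    simp at this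
  have hZN {v : V ℂ} (hv : v ∈ Z l) : N.map (Int.castRingHom ℂ) *ᵥ v ∈ Z l := by
    rw [hN, signedTurn_map, Matrix.smul_mulVec]
    exact Submodule.smul_mem _ _ (turn_mulVec_mem_Z hl.2.2.1 hl.2.2.2 hv)
  have hcomplex (ε : ℤˣ) : complexify (((ε : ℤ) : ℚ) • omegaK ρ)
      = ((ε : ℤ) : ℂ) • (swapMatrix ℂ * (N.map (Int.castRingHom ℂ))ᵀ) := by
    have : complexify (omegaK ρ) = swapMatrix ℂ * (N.map (Int.castRingHom ℂ))ᵀ := by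
      rw [omegaK_eq hρ, complexify, Matrix.map_mul, swapMatrix_map, Matrix.transpose_map,
        signedTurn_map_map]
    rw [← this]
    ext i j
    simp [complexify]
  have hdot (ε : ℤˣ) (φ ψ : Idx → ℂ) : φ ⬝ᵥ complexify (((ε : ℤ) : ℚ) • omegaK ρ) *ᵥ ψ
      = ((ε : ℤ) : ℂ) * form (N.map (Int.castRingHom ℂ) *ᵥ swapMatrix ℂ *ᵥ φ)
        (swapMatrix ℂ *ᵥ ψ) := by
    rw [hcomplex, Matrix.smul_mulVec, dotProduct_smul, dotProduct_omegaK, smul_eq_mul]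
  -- The identification by `form` sends `φ` into `Z l̄`, so `u` is the conjugate of its image. On
  -- `u` the operator `turn h s` may be replaced by `cliffProd`, which is real, so the value splits
  -- over real and imaginary parts.
  have hpos (φ : Idx → ℂ) (hφ : φ ∈ annihilator (conjSubspace (Z l))) :
      ∃ u : V ℂ, (φ ≠ 0 → u ≠ 0) ∧ ∀ ε : ℤˣ,
        form (rePart l) (rePart l)
          * (-Complex.I * (φ ⬝ᵥ (complexify (((ε : ℤ) : ℚ) • omegaK ρ)).mulVec (star φ))).re
        = ((ε * δ : ℤˣ) : ℤ) * (4 *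
          (form (rePart u) (cliffProd (positiveFrame h s l) *ᵥ rePart u)
            + form (imPart u) (cliffProd (positiveFrame h s l) *ᵥ imPart u))) := by
    have hls' : form (star l) (star l) = 0 := by rw [form_star_star, hl.1, star_zero]
    rw [conjSubspace_Z] at hφ
    have hJ := swapMatrix_mulVec_mem_Z hls' hφ
    have hJs : star (swapMatrix ℂ *ᵥ φ) = swapMatrix ℂ *ᵥ star φ := by
      rw [star_mulVec_map, swapMatrix_map]
    set u := swapMatrix ℂ *ᵥ star φ with hu
    have huZ : u ∈ Z l := by
      rw [← conjSubspace_Z] at hJ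
      rw [← hJs]
      exact hJ
    have hφu : swapMatrix ℂ *ᵥ φ = star u := by rw [← hJs, star_star]
    refine ⟨u, fun hφ0 hu0 => hφ0 ?_, fun ε => ?_⟩
    · have := congrArg (swapMatrix ℂ *ᵥ ·) hu0
      simp only [hu, Matrix.mulVec_mulVec, swapMatrix_mul_self, Matrix.one_mulVec,
        Matrix.mulVec_zero, star_eq_zero] at this
      exact this
    · rw [hdot, hφu, ← hu, form_signedTurn_map hperp, signedTurn_map, Matrix.smul_mulVec,
        form_smul_right, ← re_form_star_mulVec]
      have key := congrArg (form (star u)) (cliffProd_mulVec_of_mem_Z (h := h) (s := s) huZ)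
      rw [form_smul_right, form_smul_right] at key
      have e1 : ((form (rePart l) (rePart l) : ℝ) : ℂ) * (-Complex.I * (((ε : ℤ) : ℂ) *
          -(((δ : ℤ) : ℂ) * form (star u) (turn (ofLattice ℂ h) (ofLattice ℂ s) *ᵥ u))))
          = ((((ε * δ : ℤˣ) : ℤ) * 4 : ℝ) : ℂ) * form (star u)
            ((cliffProd (positiveFrame h s l)).map Complex.ofRealHom *ᵥ u) := by
        push_cast
        linear_combination (-((ε : ℤ) : ℂ) * ((δ : ℤ) : ℂ)) * key
      have e2 := congrArg Complex.re e1
      rw [Complex.re_ofReal_mul, Complex.re_ofReal_mul] at e2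
      rw [e2]
      ring
  have hx := (form_rePart_self hl).1
  obtain ⟨η, hη⟩ : ∃ η : ℤˣ, ∀ v : Idx → ℝ, v ≠ 0 →
      0 < (((η : ℤ) : ℝ)) * form v (cliffProd (positiveFrame h s l) *ᵥ v) := by
    rcases cliffProd_definite (positiveFrame_pos hh hs hl) (positiveFrame_orthogonal hperp hl)
      with hdef | hdef
    · exact ⟨1, fun v hv => by simpa using hdef v hv⟩
    · exact ⟨-1, fun v hv => by simpa using hdef v hv⟩
  have hη' (v : Idx → ℝ) :
      0 ≤ (((η : ℤ) : ℝ)) * form v (cliffProd (positiveFrame h s l) *ᵥ v) := by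
    rcases eq_or_ne v 0 with rfl | hv
    · simp [form]
    · exact (hη v hv).le
  -- `η` is the sign of the definite form and `δ` the sign of `√-d` relative to `turn h s`.
  refine ⟨η * δ, ?_, ?_, ?_, ?_⟩
  · have hskew := swapMatrix_mul_transpose (form_signedTurn_map (R := ℚ) (δ := δ) hperp)
    rw [Matrix.transpose_smul, omegaK_eq hρ]
    nth_rewrite 2 [hskew]
    rw [Matrix.transpose_mul, Matrix.transpose_transpose, swapMatrix_transpose, smul_neg, neg_neg]
  · refine ⟨((η * δ : ℤˣ) : ℤ) • (swapMatrix ℤ * Nᵀ), ?_⟩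
    have : omegaK ρ = (swapMatrix ℤ * Nᵀ).map (Int.castRingHom ℚ) := by
      rw [omegaK_eq hρ, Matrix.map_mul, swapMatrix_map, Matrix.transpose_map]
    rw [this]
    ext i j
    simp [-Matrix.map_mul, -zsmul_eq_mul]
  · intro φ hφ ψ hψ
    rw [hdot, form_eq_zero_of_mem_Z hls (hZN (swapMatrix_mulVec_mem_Z hl.1 hφ))
      (swapMatrix_mulVec_mem_Z hl.1 hψ), mul_zero]
  · intro φ hφ hφ0
    obtain ⟨u, hu, hval⟩ := hpos φ hφ
    refine pos_of_mul_pos_right ?_ hx.le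
    rw [hval, mul_assoc η δ δ, Int.units_mul_self, mul_one]
    have hu0 : rePart u ≠ 0 ∨ imPart u ≠ 0 := by
      by_contra! h0
      refine hu hφ0 ?_
      rw [eq_re_add_im u, h0.1, h0.2]
      funext i
      simp
    have h1 := hη' (rePart u)
    have h2 := hη' (imPart u)
    rcases hu0 with h0 | h0
    · have := hη _ h0
      linarith
    · have := hη _ h0
      linarith

theorem exists_isPolarizedWeilType (hperp : form h s = 0) (hh : 0 < form h h) (hs : 0 < form s s)
    (hd : d = ((form h h * form s s : ℤ) : ℚ)) (hl : l ∈ periodDomain h s)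
    (hρ : ρ (sqrtNeg d) = (signedTurn δ h s).map (Int.castRingHom ℚ)) :
    ∃ ε : ℤˣ, IsPolarizedWeilType d (Z l) ρ (((ε : ℤ) : ℚ) • omegaK ρ) := by
  have hd0 : 0 < d := by rw [hd]; exact_mod_cast mul_pos hh hs
  have hls : form l (star l) ≠ 0 := fun h0 => by
    have := hl.2.1
    rw [h0] at this
    simp at this
  have hNN := signedTurn_map_mul_self (δ := δ) hperp hd
  have hNC : complexify ((signedTurn δ h s).map (Int.castRingHom ℚ))
      = ((δ : ℤ) : ℂ) • turn (ofLattice ℂ h) (ofLattice ℂ s) := by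
    rw [complexify, signedTurn_map_map, signedTurn_map]
  have hZN : ∀ v ∈ Z l, complexify ((signedTurn δ h s).map (Int.castRingHom ℚ)) *ᵥ v ∈ Z l := by
    intro v hv
    rw [hNC, Matrix.smul_mulVec]
    exact Submodule.smul_mem _ _ (turn_mulVec_mem_Z hl.2.2.1 hl.2.2.2 hv)
  obtain ⟨ε, hε⟩ := isPolarization_omegaK hperp hh hs hl hρ
  obtain ⟨T, hTZ, hT, hTN⟩ := exists_anticommute hperp hh hs hl
  refine ⟨ε, isCompl_Z_conjSubspace hl.1 hls, fun x v hv => ?_, hε, fun x hx => ?_, fun x => ?_⟩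
  · rw [complexify_map_mulVec hρ]
    exact add_mem (Submodule.smul_mem _ _ hv) (Submodule.smul_mem _ _ (hZN v hv))
  · refine eigenIn_sup_and_finrank hρ hd0 hNN hZN hTZ hT ?_ hx
    rw [hNC, Matrix.mul_smul, Matrix.smul_mul, hTN, smul_neg]
  · rw [Matrix.mul_smul, Matrix.smul_mul, map_mul_omegaK_mul hρ hNN
      (swapMatrix_mul_transpose (form_signedTurn_map hperp)), smul_comm]

end Polarization

/-! ### Hermitian forms with an isotropic plane -/

section HermitianDet

variable {L : Type*} [Field L] [StarRing L]

/-- Exchanging the two pairs of columns is an even permutation and makes the matrix block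
triangular, so no sign appears. -/
theorem det_fromBlocks_zero_self (X Y : Matrix (Fin 2) (Fin 2) L) :
    (Matrix.fromBlocks 0 X Xᴴ Y).det = X.det * star X.det := by
  have h := Matrix.det_permute' (Equiv.sumComm (Fin 2) (Fin 2)) (Matrix.fromBlocks 0 X Xᴴ Y)
  have h1 : Equiv.Perm.sign (Equiv.sumComm (Fin 2) (Fin 2)) = 1 := by decide
  have h2 : (Matrix.fromBlocks 0 X Xᴴ Y).submatrix id (Equiv.sumComm (Fin 2) (Fin 2))
      = Matrix.fromBlocks X 0 Y Xᴴ := by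
    ext i j
    rcases i with i | i <;> rcases j with j | j <;> rfl
  rw [h1, h2, Matrix.det_fromBlocks_zero₁₂, Matrix.det_conjTranspose] at h
  simpa using h.symm

/-- A Hermitian form of rank four with an isotropic plane has trivial discriminant. -/
theorem exists_det_eq_mul_star {G : Matrix (Fin 4) (Fin 4) L} (hG : Gᴴ = G)
    {v : Fin 2 → Fin 4 → L} (hv : LinearIndependent L v)
    (hiso : ∀ i j, star (v i) ⬝ᵥ G *ᵥ v j = 0) : ∃ x : L, G.det = x * star x := by
  let B := Module.Basis.sumExtend hv
  have : Finite (Fin 2 ⊕ Module.Basis.sumExtendIndex hv) := Module.Finite.finite_basis B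
  have : Finite (Module.Basis.sumExtendIndex hv) := Finite.sum_right (Fin 2)
  have := Fintype.ofFinite (Module.Basis.sumExtendIndex hv)
  have hcard : Fintype.card (Module.Basis.sumExtendIndex hv) = Fintype.card (Fin 2) := by
    have := Module.finrank_eq_card_basis B
    rw [Fintype.card_sum] at this
    simp at this
    simp
    omega
  let e : Fin 2 ⊕ Fin 2 ≃ Fin 4 := finSumFinEquiv
  let b := (B.reindex (Equiv.sumCongr (Equiv.refl (Fin 2)) (Fintype.equivOfCardEq hcard))).reindex e
  have hb (i : Fin 2) : b (e (Sum.inl i)) = v i := by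
    simp [b, B, Module.Basis.sumExtend]
    rfl
  let P : Matrix (Fin 4) (Fin 4) L := (Matrix.of b)ᵀ
  have hP : P.det ≠ 0 := by
    have : IsUnit (Matrix.of b) :=
      Matrix.linearIndependent_rows_iff_isUnit.1 b.linearIndependent
    rw [Matrix.det_transpose]
    exact ((Matrix.isUnit_iff_isUnit_det _).1 this).ne_zero
  have hentry (i j) : (Pᴴ * G * P) i j = star (b i) ⬝ᵥ G *ᵥ b j := by
    rw [Matrix.mul_assoc]
    rfl
  have hherm : (Pᴴ * G * P)ᴴ = Pᴴ * G * P := by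
    rw [Matrix.conjTranspose_mul, Matrix.conjTranspose_mul, Matrix.conjTranspose_conjTranspose, hG,
      Matrix.mul_assoc]
  set M := (Pᴴ * G * P).submatrix e e with hM
  have hblocks : M = Matrix.fromBlocks 0 M.toBlocks₁₂ M.toBlocks₁₂ᴴ M.toBlocks₂₂ := by
    nth_rewrite 1 [← Matrix.fromBlocks_toBlocks M]
    congr 1
    · ext i j
      change (Pᴴ * G * P) (e (Sum.inl i)) (e (Sum.inl j)) = 0
      rw [hentry, hb, hb, hiso]
    · ext i j
      exact (congrFun (congrFun hherm (e (Sum.inr i))) (e (Sum.inl j))).symm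
  have hdet : M.det = star P.det * P.det * G.det := by
    rw [hM, Matrix.det_submatrix_equiv_self, Matrix.det_mul, Matrix.det_mul,
      Matrix.det_conjTranspose]
    ring
  rw [hblocks, det_fromBlocks_zero_self] at hdet
  have hP' : star P.det ≠ 0 := star_ne_zero.2 hP
  -- The change of basis `P` multiplies the determinant by `det P` times its conjugate, so dividing
  -- by `det P` stays within norms.
  refine ⟨M.toBlocks₁₂.det / P.det, ?_⟩
  rw [star_div₀]
  field_simp
  linear_combination -hdet

end HermitianDet

/-! ### Homology as a vector space over `K` -/

section Module

variable {d : ℚ}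

/-- The `K`-module structure on `H_1(A, ℚ)`. -/
abbrev homologyModule (ρ : K d →ₐ[ℚ] Matrix Idx Idx ℚ) : Module (K d) (Idx → ℚ) where
  smul x v := (ρ x)ᵀ *ᵥ v
  one_smul v := by
    change (ρ 1)ᵀ *ᵥ v = v
    rw [map_one, Matrix.transpose_one, Matrix.one_mulVec]
  mul_smul x y v := by
    change (ρ (x * y))ᵀ *ᵥ v = (ρ x)ᵀ *ᵥ ((ρ y)ᵀ *ᵥ v)
    rw [mul_comm, map_mul, Matrix.transpose_mul, Matrix.mulVec_mulVec]
  smul_zero x := Matrix.mulVec_zero _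
  smul_add x v w := Matrix.mulVec_add _ _ _
  add_smul x y v := by
    change (ρ (x + y))ᵀ *ᵥ v = (ρ x)ᵀ *ᵥ v + (ρ y)ᵀ *ᵥ v
    rw [map_add, Matrix.transpose_add, Matrix.add_mulVec]
  zero_smul v := by
    change (ρ 0)ᵀ *ᵥ v = 0
    rw [map_zero, Matrix.transpose_zero, Matrix.zero_mulVec]

theorem exists_isKBasis (hd : 0 < d) (ρ : K d →ₐ[ℚ] Matrix Idx Idx ℚ) :
    ∃ (n : ℕ) (b : Fin n → Idx → ℚ), IsKBasis ρ b := by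
  have := fact_sq_ne hd
  let _ := homologyModule ρ
  have : IsScalarTower ℚ (K d) (Idx → ℚ) := ⟨fun a x v => by
    change (ρ (a • x))ᵀ *ᵥ v = a • ((ρ x)ᵀ *ᵥ v)
    rw [map_smul, Matrix.transpose_smul, Matrix.smul_mulVec]⟩
  have : Module.Finite (K d) (Idx → ℚ) := Module.Finite.of_restrictScalars_finite ℚ (K d) _
  let b := Module.finBasis (K d) (Idx → ℚ)
  refine ⟨_, b, ?_⟩
  have h : (fun c : Fin _ → K d => ∑ i, (ρ (c i))ᵀ *ᵥ b i) = b.equivFun.symm := by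
    funext c
    rw [Module.Basis.equivFun_symm_apply]
    rfl
  rw [IsKBasis, h]
  exact b.equivFun.symm.bijective

end Module

/-! ### Rational isotropic spinors -/

section IsotropicPlane

/-- The image of `cliffAdj z` lies in this kernel, and its rank is at least that of `cliff z`
because the two are adjoint; rank plus nullity is eight. -/
theorem four_le_finrank_ker {z : SPlus ℚ} (hz : form z z = 0) :
    4 ≤ Module.finrank ℚ (LinearMap.ker (Matrix.mulVecLin (cliff z))) := by
  have h1 := LinearMap.finrank_range_add_finrank_ker (Matrix.mulVecLin (cliff z))
  have h2 : (cliff z).rank ≤ (cliffAdj z).rank := by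
    have : cliff z = swapMatrix ℚ * ((cliffAdj z)ᵀ * swapMatrix ℚ) := by
      rw [cliffAdj_eq, Matrix.transpose_mul, Matrix.transpose_mul, swapMatrix_transpose,
        Matrix.transpose_transpose]
      simp only [Matrix.mul_assoc, swapMatrix_mul_self, Matrix.mul_one]
      rw [← Matrix.mul_assoc, swapMatrix_mul_self, Matrix.one_mul]
    calc (cliff z).rank = (swapMatrix ℚ * ((cliffAdj z)ᵀ * swapMatrix ℚ)).rank := by rw [← this]
      _ ≤ ((cliffAdj z)ᵀ * swapMatrix ℚ).rank := Matrix.rank_mul_le_right _ _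
      _ ≤ (cliffAdj z)ᵀ.rank := Matrix.rank_mul_le_left _ _
      _ = (cliffAdj z).rank := Matrix.rank_transpose _
  have h3 : LinearMap.range (Matrix.mulVecLin (cliffAdj z))
      ≤ LinearMap.ker (Matrix.mulVecLin (cliff z)) := by
    rintro _ ⟨w, rfl⟩
    exact (mem_Z_iff _ _).1 (cliffAdj_mulVec_mem_Z hz w)
  have h4 := Submodule.finrank_mono h3
  have h5 : Module.finrank ℚ (V ℚ) = 8 := by simp
  rw [h5] at h1
  rw [Matrix.rank, Matrix.rank] at h2
  omega

/-- Two linear conditions cannot exhaust the four-dimensional totally isotropic space of spinors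
supported on the `inl` coordinates. -/
theorem exists_isotropic_orthogonal (x y : SPlus ℚ) :
    ∃ z : SPlus ℚ, z ≠ 0 ∧ form z z = 0 ∧ form z x = 0 ∧ form z y = 0 := by
  let f : (Fin 4 → ℚ) →ₗ[ℚ] (Fin 2 → ℚ) :=
    Matrix.toLin' (Matrix.of ![x ∘ Sum.inr, y ∘ Sum.inr])
  have hker : LinearMap.ker f ≠ ⊥ := f.ker_ne_bot_of_finrank_lt (by simp)
  obtain ⟨a, ha, hne⟩ := (Submodule.ne_bot_iff _).1 hker
  have h0 := congrFun ha 0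
  have h1 := congrFun ha 1
  refine ⟨Sum.elim a 0, fun h => hne ?_, ?_, ?_, ?_⟩
  · funext i
    exact congrFun h (Sum.inl i)
  · simp [form]
  · simpa [form, f, Matrix.mulVec, dotProduct, mul_comm] using h0
  · simpa [form, f, Matrix.mulVec, dotProduct, mul_comm] using h1

end IsotropicPlane

/-! ### The Hermitian form and its discriminant -/

section Hermitian

variable {d : ℚ} {ρ : K d →ₐ[ℚ] Matrix Idx Idx ℚ} {N ω : Matrix Idx Idx ℚ}

theorem hermitian_eq (hρ : ρ (sqrtNeg d) = N) (x y : Idx → ℚ) :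
    hermitian ρ ω x y = ⟨x ⬝ᵥ ω *ᵥ (Nᵀ *ᵥ y), x ⬝ᵥ ω *ᵥ y⟩ := by
  rw [hermitian, hρ]
  ext <;> simp [sqrtNeg, QuadraticAlgebra.algebraMap_eq]

theorem transpose_map_mulVec (hρ : ρ (sqrtNeg d) = N) (a : K d) (y : Idx → ℚ) :
    (ρ a)ᵀ *ᵥ y = a.re • y + a.im • (Nᵀ *ᵥ y) := by
  rw [map_eq_re_add_im, hρ, Matrix.transpose_add, Matrix.transpose_smul, Matrix.transpose_smul,
    Matrix.transpose_one, Matrix.add_mulVec, Matrix.smul_mulVec, Matrix.smul_mulVec,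
    Matrix.one_mulVec]

theorem hermitian_smul_right (hρ : ρ (sqrtNeg d) = N) (hNN : N * N = (-d) • 1) (a : K d)
    (x y : Idx → ℚ) : hermitian ρ ω x ((ρ a)ᵀ *ᵥ y) = hermitian ρ ω x y * a := by
  have h (w : Idx → ℚ) : Nᵀ *ᵥ (Nᵀ *ᵥ w) = (-d) • w := by
    rw [Matrix.mulVec_mulVec, ← Matrix.transpose_mul, hNN, Matrix.transpose_smul,
      Matrix.transpose_one, Matrix.smul_mulVec, Matrix.one_mulVec]
  rw [hermitian_eq hρ, hermitian_eq hρ, transpose_map_mulVec hρ]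
  simp only [Matrix.mulVec_add, Matrix.mulVec_smul, h, dotProduct_add, dotProduct_smul,
    smul_eq_mul]
  ext
  · simp; ring
  · simp; ring

theorem star_hermitian (hρ : ρ (sqrtNeg d) = N) (hω : ωᵀ = -ω) (hNω : ω * Nᵀ = -(N * ω))
    (x y : Idx → ℚ) : star (hermitian ρ ω x y) = hermitian ρ ω y x := by
  have h (x y : Idx → ℚ) : y ⬝ᵥ ω *ᵥ x = -(x ⬝ᵥ ω *ᵥ y) := by
    rw [← Matrix.dotProduct_transpose_mulVec, hω, Matrix.neg_mulVec, dotProduct_neg]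
  have h2 : y ⬝ᵥ ω *ᵥ Nᵀ *ᵥ x = x ⬝ᵥ ω *ᵥ Nᵀ *ᵥ y := by
    rw [Matrix.mulVec_mulVec, ← Matrix.dotProduct_transpose_mulVec, Matrix.transpose_mul,
      Matrix.transpose_transpose, hω, Matrix.mul_neg, ← hNω, Matrix.mulVec_mulVec]
  rw [hermitian_eq hρ, hermitian_eq hρ, h2, h x y]
  ext <;> simp

theorem hermitian_sum_right {n : ℕ} (hρ : ρ (sqrtNeg d) = N) (hNN : N * N = (-d) • 1)
    (x : Idx → ℚ) (b : Fin n → Idx → ℚ) (c : Fin n → K d) :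
    hermitian ρ ω x (∑ i, (ρ (c i))ᵀ *ᵥ b i) = ∑ i, hermitian ρ ω x (b i) * c i := by
  simp only [← hermitian_smul_right hρ hNN]
  have hadd (y z : Idx → ℚ) : hermitian ρ ω x (y + z) = hermitian ρ ω x y + hermitian ρ ω x z := by
    simp only [hermitian_eq hρ, Matrix.mulVec_add, dotProduct_add]
    rfl
  exact map_sum (AddMonoidHom.mk' (hermitian ρ ω x) hadd) _ _

theorem hermitian_sum_sum {n : ℕ} (hρ : ρ (sqrtNeg d) = N) (hNN : N * N = (-d) • 1)
    (hω : ωᵀ = -ω) (hNω : ω * Nᵀ = -(N * ω)) (b : Fin n → Idx → ℚ) (c e : Fin n → K d) :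
    hermitian ρ ω (∑ i, (ρ (c i))ᵀ *ᵥ b i) (∑ i, (ρ (e i))ᵀ *ᵥ b i)
      = star c ⬝ᵥ (Matrix.of fun i j => hermitian ρ ω (b i) (b j)) *ᵥ e := by
  rw [hermitian_sum_right hρ hNN]
  simp only [← star_hermitian hρ hω hNω _ (∑ i, (ρ (c i))ᵀ *ᵥ b i), hermitian_sum_right hρ hNN,
    star_sum, star_mul']
  simp only [star_hermitian hρ hω hNω, Matrix.mulVec, dotProduct, Finset.mul_sum, Finset.sum_mul,
    Matrix.of_apply, Pi.star_apply]
  rw [Finset.sum_comm]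
  exact Finset.sum_congr rfl fun i _ => Finset.sum_congr rfl fun j _ => by ring

theorem eq_zero_of_hermitian_eq_zero (hρ : ρ (sqrtNeg d) = N) (hω : IsUnit ω) {y : Idx → ℚ}
    (hy : ∀ x, hermitian ρ ω x y = 0) : y = 0 := by
  have h : ω *ᵥ y = 0 := by
    refine dotProduct_eq_zero _ fun x => ?_
    have := congrArg QuadraticAlgebra.im (hy x)
    rw [hermitian_eq hρ] at this
    rw [dotProduct_comm]
    exact this
  exact (Matrix.mulVec_injective_iff_isUnit.2 hω) (by rw [h, Matrix.mulVec_zero])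

end Hermitian

/-- The isotropic plane comes from a rational spinor and does not depend on `c`, so neither
positivity nor the sign of the form plays a role. -/
theorem hasTrivialDiscriminant_smul_omegaK {d : ℚ} {h s : SPlus ℤ} {δ : ℤˣ}
    {ρ : K d →ₐ[ℚ] Matrix Idx Idx ℚ} (hperp : form h s = 0) (hh : 0 < form h h)
    (hs : 0 < form s s) (hd : d = ((form h h * form s s : ℤ) : ℚ))
    (hρ : ρ (sqrtNeg d) = (signedTurn δ h s).map (Int.castRingHom ℚ)) {c : ℚ} (hc : c ≠ 0) :
    HasTrivialDiscriminant ρ (c • omegaK ρ) := by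
  have hd0 : 0 < d := by rw [hd]; exact_mod_cast mul_pos hh hs
  refine ⟨exists_isKBasis hd0 ρ, fun n b hb => ?_⟩
  have := fact_sq_ne hd0
  have hNN := signedTurn_map_mul_self (δ := δ) hperp hd
  have hskew := swapMatrix_mul_transpose (form_signedTurn_map (R := ℚ) (δ := δ) hperp)
  have hstable {z : SPlus ℚ} (hzh : form z (ofLattice ℚ h) = 0) (hzs : form z (ofLattice ℚ s) = 0)
      {v : V ℚ} (hv : v ∈ Z z) : (signedTurn δ h s).map (Int.castRingHom ℚ) *ᵥ v ∈ Z z := by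
    rw [signedTurn_map, Matrix.smul_mulVec]
    exact Submodule.smul_mem _ _ (turn_mulVec_mem_Z hzh hzs hv)
  have hω_eq : omegaK ρ = swapMatrix ℚ * ((signedTurn δ h s).map (Int.castRingHom ℚ))ᵀ :=
    omegaK_eq hρ
  generalize (signedTurn δ h s).map (Int.castRingHom ℚ) = N at *
  set ω := c • omegaK ρ with hω_def
  have hω : ωᵀ = -ω := by
    rw [hω_def, hω_eq, Matrix.transpose_smul, Matrix.transpose_mul, Matrix.transpose_transpose,
      swapMatrix_transpose, hskew, smul_neg, neg_neg]
  have hNω : ω * Nᵀ = -(N * ω) := by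
    rw [hω_def, hω_eq, Matrix.smul_mul, hskew, Matrix.mul_smul, Matrix.mul_neg, Matrix.neg_mul,
      smul_neg, smul_neg, neg_neg, Matrix.mul_assoc, hskew, Matrix.mul_neg, smul_neg, neg_neg]
  have hωunit : IsUnit ω := by
    -- The inverse comes from `Nᵀ * Nᵀ = -d` and the fact that `swapMatrix` is an involution.
    refine IsUnit.of_mul_eq_one ((-(c * d)⁻¹) • (Nᵀ * swapMatrix ℚ)) ?_
    have : Nᵀ * Nᵀ = (-d) • 1 := by
      rw [← Matrix.transpose_mul, hNN, Matrix.transpose_smul, Matrix.transpose_one]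
    rw [hω_def, hω_eq, Matrix.smul_mul, Matrix.mul_smul, Matrix.mul_assoc,
      ← Matrix.mul_assoc Nᵀ, this, Matrix.smul_mul, Matrix.mul_smul, Matrix.one_mul,
      swapMatrix_mul_self, smul_smul, smul_smul]
    have h1 : c * (-(c * d)⁻¹ * -d) = 1 := by field_simp
    rw [mul_assoc, h1, one_smul]
  -- a rational isotropic plane over `K`
  obtain ⟨z, hz0, hzz, hzh, hzs⟩ := exists_isotropic_orthogonal (ofLattice ℚ h) (ofLattice ℚ s)
  obtain ⟨m, hzm⟩ : ∃ m, form z m ≠ 0 := by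
    by_contra! h0
    exact hz0 (eq_zero_of_form_eq_zero h0)
  let _ := homologyModule ρ
  have : IsScalarTower ℚ (K d) (Idx → ℚ) := ⟨fun a x v => by
    change (ρ (a • x))ᵀ *ᵥ v = a • ((ρ x)ᵀ *ᵥ v)
    rw [map_smul, Matrix.transpose_smul, Matrix.smul_mulVec]⟩
  have : Module.Finite (K d) (Idx → ℚ) := Module.Finite.of_restrictScalars_finite ℚ (K d) _
  have hsmul (x : K d) (v : Idx → ℚ) : x • v = (ρ x)ᵀ *ᵥ v := rfl
  have hJN (v : Idx → ℚ) : swapMatrix ℚ *ᵥ (Nᵀ *ᵥ v) = -(N *ᵥ (swapMatrix ℚ *ᵥ v)) := by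
    rw [Matrix.mulVec_mulVec, hskew, Matrix.neg_mulVec, Matrix.mulVec_mulVec]
  have hNW {v : Idx → ℚ} (hv : swapMatrix ℚ *ᵥ v ∈ Z z) : swapMatrix ℚ *ᵥ (Nᵀ *ᵥ v) ∈ Z z := by
    rw [hJN]
    exact neg_mem (hstable hzh hzs hv)
  -- `W` is `Z z` transported to homology by `form`. Stability under `N` makes it a `K`-subspace,
  -- and isotropy together with stability kills both components of the Hermitian form.
  let W : Submodule (K d) (Idx → ℚ) :=
    { carrier := {v | swapMatrix ℚ *ᵥ v ∈ Z z}
      zero_mem' := by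
        change swapMatrix ℚ *ᵥ 0 ∈ Z z
        rw [Matrix.mulVec_zero]
        exact zero_mem _
      add_mem' := fun {v w} hv hw => by
        change swapMatrix ℚ *ᵥ (v + w) ∈ Z z
        rw [Matrix.mulVec_add]
        exact add_mem hv hw
      smul_mem' := fun x v hv => by
        change swapMatrix ℚ *ᵥ ((ρ x)ᵀ *ᵥ v) ∈ Z z
        rw [transpose_map_mulVec hρ, Matrix.mulVec_add, Matrix.mulVec_smul, Matrix.mulVec_smul]
        exact add_mem (Submodule.smul_mem _ _ hv) (Submodule.smul_mem _ _ (hNW hv)) }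
  have hWω {v w : Idx → ℚ} (hv : v ∈ W) (hw : w ∈ W) : v ⬝ᵥ ω *ᵥ w = 0 := by
    rw [hω_def, hω_eq, Matrix.smul_mulVec, dotProduct_smul, dotProduct_omegaK,
      form_eq_zero_of_mem_Z hzm (hstable hzh hzs hv) hw, smul_zero]
  have hWH {v w : Idx → ℚ} (hv : v ∈ W) (hw : w ∈ W) : hermitian ρ ω v w = 0 := by
    rw [hermitian_eq hρ, hWω hv hw, hWω hv (hNW hw)]
    rfl
  have : Module.Finite ℚ W := Module.Finite.trans (K d) W
  have hW4 : 4 ≤ Module.finrank ℚ W := by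
    refine (four_le_finrank_ker hzz).trans ?_
    let f : LinearMap.ker (Matrix.mulVecLin (cliff z)) →ₗ[ℚ] W :=
      { toFun := fun v => ⟨swapMatrix ℚ *ᵥ v.1, by
          change swapMatrix ℚ *ᵥ (swapMatrix ℚ *ᵥ v.1) ∈ Z z
          rw [Matrix.mulVec_mulVec, swapMatrix_mul_self, Matrix.one_mulVec, mem_Z_iff]
          exact v.2⟩
        map_add' := fun v w => Subtype.ext (by
          change swapMatrix ℚ *ᵥ (v.1 + w.1) = swapMatrix ℚ *ᵥ v.1 + swapMatrix ℚ *ᵥ w.1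
          exact Matrix.mulVec_add _ _ _)
        map_smul' := fun a v => Subtype.ext (by
          change swapMatrix ℚ *ᵥ (a • v.1) = a • (swapMatrix ℚ *ᵥ v.1)
          exact Matrix.mulVec_smul _ _ _) }
    refine LinearMap.finrank_le_finrank_of_injective (f := f) fun v w hvw => Subtype.ext ?_
    have := congrArg (fun x : W => swapMatrix ℚ *ᵥ x.1) hvw
    simpa [f, Matrix.mulVec_mulVec, swapMatrix_mul_self] using this
  have hK2 : Module.finrank ℚ (K d) = 2 := QuadraticAlgebra.finrank_eq_two _ _
  have hW2 : 2 ≤ Module.finrank (K d) W := by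
    have := Module.finrank_mul_finrank ℚ (K d) W
    rw [hK2] at this
    omega
  have hV4 : Module.finrank (K d) (Idx → ℚ) = 4 := by
    have := Module.finrank_mul_finrank ℚ (K d) (Idx → ℚ)
    have h8 : Module.finrank ℚ (Idx → ℚ) = 8 := by simp
    rw [hK2, h8] at this
    omega
  -- coordinates with respect to the given basis
  let Φ : (Fin n → K d) ≃ₗ[K d] (Idx → ℚ) :=
    LinearEquiv.ofBijective (Fintype.linearCombination (K d) b) hb
  have hΦ (e : Fin n → K d) : Φ e = ∑ i, (ρ (e i))ᵀ *ᵥ b i := rfl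
  obtain rfl : n = 4 := by
    have := Φ.finrank_eq
    rwa [hV4, Module.finrank_fin_fun] at this
  set G : Matrix (Fin 4) (Fin 4) (K d) := Matrix.of fun i j => hermitian ρ ω (b i) (b j) with hG
  have hGΦ (e f : Fin 4 → K d) : hermitian ρ ω (Φ e) (Φ f) = star e ⬝ᵥ G *ᵥ f := by
    rw [hΦ, hΦ, hermitian_sum_sum hρ hNN hω hNω]
  have hGstar : Gᴴ = G := by
    ext1 i j
    exact star_hermitian hρ hω hNω _ _
  have hGdet : G.det ≠ 0 := by
    intro h0
    obtain ⟨f, hf0, hf⟩ := Matrix.exists_mulVec_eq_zero_iff.2 h0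
    refine hf0 (Φ.map_eq_zero_iff.1 (eq_zero_of_hermitian_eq_zero (ω := ω) hρ hωunit fun x => ?_))
    rw [← Φ.apply_symm_apply x, hGΦ, hf, dotProduct_zero]
  obtain ⟨w, hw⟩ := exists_linearIndependent_of_le_finrank hW2
  obtain ⟨x, hx⟩ := exists_det_eq_mul_star hGstar (v := fun i => Φ.symm (w i).1)
    ((hw.map' W.subtype W.ker_subtype).map' Φ.symm.toLinearMap Φ.symm.ker) fun i j => by
      rw [← hGΦ, Φ.apply_symm_apply, Φ.apply_symm_apply, hWH (w i).2 (w j).2]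
  refine ⟨x, ?_, ?_⟩
  · rintro rfl
    exact hGdet (by rw [hx, zero_mul])
  · rw [QuadraticAlgebra.algebraMap_norm_eq_mul_star]
    exact hx

end SpinorTori

theorem mainTheorem7 (h s : SPlus ℤ) (h_perp : form h s = 0)
    (h_rank : LinearIndependent ℤ ![h, s])
    (h_pos : ∀ v ∈ Submodule.span ℤ ({h, s} : Set (SPlus ℤ)), v ≠ 0 → 0 < form v v)
    (d : ℚ) (hd : d = ((form h h * form s s : ℤ) : ℚ))
    (κ : SPlus (K d))
    (hκ_mem : κ ∈ Submodule.span (K d) ({ofLattice (K d) h, ofLattice (K d) s} : Set (SPlus (K d))))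
    (hκ_ne : κ ≠ 0) (hκ_iso : form κ κ = 0)
    (l : SPlus ℂ) (hl : l ∈ periodDomain h s) :
    (∃! ρ : K d →ₐ[ℚ] Matrix Idx Idx ℚ, IsActionOf κ ρ) ∧
    ∀ ρ : K d →ₐ[ℚ] Matrix Idx Idx ℚ, IsActionOf κ ρ →
      (∃ ε : ℤˣ, IsPolarizedWeilType d (Z l) ρ (((ε : ℤ) : ℚ) • omegaK ρ)) ∧
      ∀ c : ℚ, c ≠ 0 → HasTrivialDiscriminant ρ (c • omegaK ρ) := by
  have hh : 0 < form h h := h_pos h (Submodule.subset_span (by simp)) (h_rank.ne_zero 0)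
  have hs : 0 < form s s := h_pos s (Submodule.subset_span (by simp)) (h_rank.ne_zero 1)
  have hd0 : d ≠ 0 := by rw [hd]; exact_mod_cast (mul_pos hh hs).ne'
  obtain ⟨δ, hδ⟩ := exists_sign_mem_Z_iff h_perp hh hs hd hκ_mem hκ_ne hκ_iso
  have hZ (v : V (K d)) : v ∈ Z κ ↔ (((signedTurn δ h s).map (Int.castRingHom ℚ)).map
      (algebraMap ℚ (K d))).mulVec v = sqrtNeg d • v := by
    rw [signedTurn_map_map, signedTurn_map]
    exact hδ v
  have hNN := signedTurn_map_mul_self (δ := δ) h_perp hd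
  refine ⟨existsUnique_isActionOf hd0 hNN hZ, fun ρ hρ => ?_⟩
  have hρ' := (isActionOf_iff hd0 hNN hZ ρ).1 hρ
  exact ⟨exists_isPolarizedWeilType h_perp hh hs hd hl hρ',
    fun c hc => hasTrivialDiscriminant_smul_omegaK h_perp hh hs hd hρ' hc⟩
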